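/- **Notation.** For $k\in(0,1)$ let $K(k)=\int_0^{\pi/2}\frac{d\theta}{\sqrt{1-k^2\sin^2\theta}}$ and let $\mathrm{cn}(\cdot;k)$ be the Jacobi elliptic cosine. Let $\mathcal P=\{(c,\beta_2)\in\mathbb R^2:\ c>1,\ 0<\beta_2<\tfrac{5(c-1)}6\}$. For $(c,\beta_2)\in\mathcal P$ put $$\Delta_c(\beta_2)=\Big(\beta_2-\tfrac{5(c-1)}4\Big)^2-4\Big(\beta_2^2-\tfrac{5(c-1)}4\beta_2\Big),\qquad \beta_3=\tfrac12\Big(\tfrac{5(c-1)}4-\beta_2\Big)+\tfrac12\sqrt{\Delta_c(\beta_2)},\qquad \beta_1=\tfrac{5(c-1)}4-\beta_2-\beta_3,$$ $$k(c,\beta_2)=\sqrt{\frac{5(c-1)-12\beta_2}{8\sqrt{\Delta_c(\beta_2)}}+\frac12},\qquad T_\phi(c,\beta_2)=\frac{4\sqrt{5c}}{\Delta_c(\beta_2)^{1/4}}\,K(k(c,\beta_2)),\qquad A=\tfrac25\beta_1\beta_2\beta_3,$$ $$\phi_{(c,\beta_2)}(z)=\Big[\beta_2+(\beta_3-\beta_2)\,\mathrm{cn}^2\Big(\sqrt{\tfrac{\beta_3-\beta_1}{16(\beta_1+\beta_2+\beta_3)+20}}\;z;\,k(c,\beta_2)\Big)\Big]^2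 .$$ $C^\infty_{per}([0,L])$ is the Fréchet space of smooth $L$-periodic functions $\mathbb R\to\mathbb R$ with the topology of uniform convergence of all derivatives; a map from an open interval into it is smooth if it has derivatives of all orders as limits of difference quotients in that topology. **Theorem 3.6.** Let $L>4\pi$ and $c_0>\frac{L^2}{L^2-16\pi^2}$. There is a unique $\beta_2^0\in\big(0,\frac{5(c_0-1)}6\big)$ with $T_\phi(c_0,\beta_2^0)=L$, and the following hold. (i) There are open intervals $J\ni c_0$ and $B\ni\beta_2^0$ with $J\times B\subseteq\mathcal P$ and a unique function $\Lambda:J\to B$ such that $\Lambda(c_0)=\beta_2^0$ and $T_\phi(c,\Lambda(c))=L$ for all $c\in J$. The function $\Lambda$ is smooth, and for $c\in J$ the modulus $k=k(c,\Lambda(c))$ lies in $(0,1)$ and satisfies $k^2=\frac{\beta_3-\beta_2}{\beta_3-\beta_1}$, where $\beta_2=\Lambda(c)$. (ii) For every $c\in J$, with $\beta_2=\Lambda(c)$ and the corresponding $\beta_1,\beta_3,A$, the function $\phi_c:=\phi_{(c,\Lambda(c))}$ is a smooth positive solution on $\mathbb R$ of $$-c\phi''+(c-1)\phi-\phi^{3/2}+A=0$$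 with fundamental (least positive) period $L$, and the map $J\ni c\mapsto\phi_c\in C^\infty_{per}([0,L])$ is smooth. (iii) $J\subseteq\big(\frac{L^2}{L^2-16\pi^2},\infty\big)$, and $\Lambda$ extends to a function on the whole interval $\big(\frac{L^2}{L^2-16\pi^2},\infty\big)$, with values in $(0,\infty)$ and with $(c,\Lambda(c))\in\mathcal P$ for all $c$, for which all assertions of (i) and (ii) hold on that interval (the uniqueness being among functions $\Lambda$ with $\Lambda(c_0)=\beta_2^0$, $(c,\Lambda(c))\in\mathcal P$ and $T_\phi(c,\Lambda(c))=L$ for all $c$; the inclusion $J\times B\subseteq\mathcal P$ is asserted only for the local intervals of (i)). -/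

import Mathlib

open Set Filter Topology
open scoped ContDiff

noncomputable section

namespace Schamel

/-! ### Jacobi elliptic functions -/

/-- The incomplete elliptic integral of the first kind `F(θ, k)`, with modulus `k`. -/
def ellipticF (k θ : ℝ) : ℝ :=
  ∫ t in (0 : ℝ)..θ, 1 / Real.sqrt (1 - k ^ 2 * Real.sin t ^ 2)

/-- The complete elliptic integral of the first kind `K(k)`. -/
def ellipticK (k : ℝ) : ℝ := ellipticF k (Real.pi / 2)

/-- The Jacobi amplitude `am(u, k)`: the inverse of the bijection `θ ↦ F(θ, k)` of the real line
(it is a bijection whenever `0 < k < 1`). -/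
def jacobiAm (u k : ℝ) : ℝ := Function.invFun (ellipticF k) u

/-- The Jacobi elliptic function `cn(u, k) = cos (am(u, k))`. -/
def jacobiCN (u k : ℝ) : ℝ := Real.cos (jacobiAm u k)

/-! ### The cnoidal waves -/

/-- The set `𝒫` of admissible parameters `(c, β₂)`. -/
def paramSet : Set (ℝ × ℝ) :=
  {p | 1 < p.1 ∧ 0 < p.2 ∧ p.2 < 5 * (p.1 - 1) / 6}

/-- `Δ_c(x)`, the discriminant of the quadratic equation satisfied by `β₃` when `β₂ = x`. -/
def disc (c x : ℝ) : ℝ :=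
  (x - 5 * (c - 1) / 4) ^ 2 - 4 * (x ^ 2 - 5 * (c - 1) / 4 * x)

/-- The root `β₃` as a function of `c` and `b = β₂`. -/
def beta3 (c b : ℝ) : ℝ :=
  1 / 2 * (5 * (c - 1) / 4 - b) + 1 / 2 * Real.sqrt (disc c b)

/-- The root `β₁` as a function of `c` and `b = β₂`. -/
def beta1 (c b : ℝ) : ℝ := 5 * (c - 1) / 4 - b - beta3 c b

/-- The elliptic modulus `k(c, β₂)`. -/
def modulus (c b : ℝ) : ℝ :=
  Real.sqrt ((5 * (c - 1) - 12 * b) / (8 * Real.sqrt (disc c b)) + 1 / 2)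

/-- The period function `T_φ(c, β₂) = 4 √(5c) Δ_c(β₂)^(-1/4) K(k(c, β₂))`. -/
def periodFun (c b : ℝ) : ℝ :=
  4 * Real.sqrt (5 * c) / disc c b ^ (1 / 4 : ℝ) * ellipticK (modulus c b)

/-- The cnoidal wave `φ_{(c, β₂)}`. -/
def wave (c b z : ℝ) : ℝ :=
  (b + (beta3 c b - b) *
    jacobiCN (Real.sqrt ((beta3 c b - beta1 c b) / (16 * (beta1 c b + b + beta3 c b) + 20)) * z)
      (modulus c b) ^ 2) ^ 2

/-- The constant `A = 2 β₁ β₂ β₃ / 5`. -/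
def constA (c b : ℝ) : ℝ := 2 * (beta1 c b * b * beta3 c b) / 5

/-- `φ` is a smooth, positive (classical) solution of `-c φ'' + (c - 1) φ - φ^(3/2) + A = 0`
on the real line. -/
def IsPositiveSolution (c A : ℝ) (φ : ℝ → ℝ) : Prop :=
  ContDiff ℝ ∞ φ ∧ ∀ x, 0 < φ x ∧
    -c * deriv (deriv φ) x + (c - 1) * φ x - φ x ^ (3 / 2 : ℝ) + A = 0

/-- `L` is the fundamental (least positive) period of `f`. -/
def IsFundamentalPeriod (f : ℝ → ℝ) (L : ℝ) : Prop :=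
  0 < L ∧ Function.Periodic f L ∧ ∀ T, 0 < T → Function.Periodic f T → L ≤ T

/-! ### The Fréchet space of smooth periodic functions -/

/-- The smooth `L`-periodic functions, as a subspace of all functions. -/
def perSubmodule (L : ℝ) : Submodule ℝ (ℝ → ℝ) where
  carrier := {f | ContDiff ℝ ∞ f ∧ Function.Periodic f L}
  zero_mem' := ⟨contDiff_const, fun _ => rfl⟩
  add_mem' := fun hf hg => ⟨hf.1.add hg.1, hf.2.add hg.2⟩
  smul_mem' := fun a _ hf => ⟨contDiff_const.smul hf.1, fun x => by simp [hf.2 x]⟩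

/-- The space `C^∞_per([0, L])`. It does not inherit the product topology of `ℝ → ℝ`; its
topology is defined below. -/
def CinfPer (L : ℝ) : Type := ↥(perSubmodule L)

instance (L : ℝ) : AddCommGroup (CinfPer L) := inferInstanceAs (AddCommGroup ↥(perSubmodule L))

instance (L : ℝ) : Module ℝ (CinfPer L) := inferInstanceAs (Module ℝ ↥(perSubmodule L))

/-- The function underlying an element of `C^∞_per([0, L])`. -/
def CinfPer.toFun {L : ℝ} (f : CinfPer L) : ℝ → ℝ := f.1

/-- The `n`-th derivative of `f`, restricted to `[0, L]`, as a linear map into `C([0, L])`. -/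
def CinfPer.derivL (L : ℝ) (n : ℕ) : CinfPer L →ₗ[ℝ] C(Set.Icc (0 : ℝ) L, ℝ) where
  toFun f := ⟨fun x => iteratedDeriv n f.1 x,
    (f.2.1.continuous_iteratedDeriv n (by exact_mod_cast le_top)).comp continuous_subtype_val⟩
  map_add' f g := by
    ext x
    exact iteratedDeriv_add ((f.2.1.of_le (by exact_mod_cast le_top)).contDiffAt)
      ((g.2.1.of_le (by exact_mod_cast le_top)).contDiffAt)
  map_smul' a f := by
    ext x
    exact iteratedDeriv_const_smul_field a f.1

/-- The seminorms `f ↦ sup_{[0, L]} |f⁽ⁿ⁾|`. -/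
def CinfPer.seminorms (L : ℝ) : SeminormFamily ℝ (CinfPer L) ℕ := fun n =>
  (normSeminorm ℝ C(Set.Icc (0 : ℝ) L, ℝ)).comp (CinfPer.derivL L n)

/-- The Fréchet topology of `C^∞_per([0, L])`: uniform convergence of all derivatives. -/
instance (L : ℝ) : TopologicalSpace (CinfPer L) :=
  (CinfPer.seminorms L).moduleFilterBasis.topology

theorem CinfPer.withSeminorms (L : ℝ) : WithSeminorms (CinfPer.seminorms L) := ⟨rfl⟩

/-- A curve `f` in a topological vector space is smooth (`C^∞`) on the open set `J ⊆ ℝ`: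
it has derivatives of all orders there, as limits of difference quotients in the topology of the
space; `g n` is the `n`-th derivative. -/
def SmoothCurveOn {E : Type*} [AddCommGroup E] [Module ℝ E] [TopologicalSpace E]
    (f : ℝ → E) (J : Set ℝ) : Prop :=
  ∃ g : ℕ → ℝ → E, EqOn (g 0) f J ∧
    ∀ n, ∀ c ∈ J, Tendsto (slope (g n) c) (𝓝[≠] c) (𝓝 (g (n + 1) c))

/-! ### The curve of waves of period `L` -/

/-- `I` is an open interval (possibly unbounded) around `x`. -/
def IsIntervalAround (I : Set ℝ) (x : ℝ) : Prop := IsOpen I ∧ I.OrdConnected ∧ x ∈ I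

/-- `Λ : J → B` is smooth with `Λ(c₀) = β₀`, it is the unique function `J → B` with this value at
`c₀` and with `T_φ(c, Λ(c)) = L` on `J`, and the cnoidal waves `φ_{(c, Λ(c))}`, `c ∈ J`, form a
smooth curve in `C^∞_per([0, L])` of positive solutions with fundamental period `L`. -/
structure IsWaveCurve (L c₀ β₀ : ℝ) (J B : Set ℝ) (Λ : ℝ → ℝ) : Prop where
  interval_J : IsIntervalAround J c₀
  interval_B : IsIntervalAround B β₀
  mapsTo : MapsTo Λ J B
  base : Λ c₀ = β₀
  admissible : ∀ c ∈ J, (c, Λ c) ∈ paramSet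
  period_eq : ∀ c ∈ J, periodFun c (Λ c) = L
  modulus_mem : ∀ c ∈ J, modulus c (Λ c) ∈ Ioo (0 : ℝ) 1
  modulus_sq : ∀ c ∈ J, modulus c (Λ c) ^ 2 =
    (beta3 c (Λ c) - Λ c) / (beta3 c (Λ c) - beta1 c (Λ c))
  unique : ∀ Λ' : ℝ → ℝ, Λ' c₀ = β₀ →
    (∀ c ∈ J, Λ' c ∈ B ∧ (c, Λ' c) ∈ paramSet ∧ periodFun c (Λ' c) = L) → EqOn Λ' Λ J
  smooth : ContDiffOn ℝ ∞ Λ J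
  solution : ∀ c ∈ J, IsPositiveSolution c (constA c (Λ c)) (wave c (Λ c))
  fundamental : ∀ c ∈ J, IsFundamentalPeriod (wave c (Λ c)) L
  smooth_wave : ∃ Φ : ℝ → CinfPer L,
    (∀ c ∈ J, (Φ c).toFun = wave c (Λ c)) ∧ SmoothCurveOn Φ J

end Schamel

end

namespace Schamel

/-! ### Smooth dependence of integrals and implicit functions on parameters -/

/-! Put s = 5(c-1)/4 and m = k². The roots have sum s and vanishing second elementary symmetric
function. From this follows √Δ · √(1-m+m²) = s (`sqrt_disc_eq`), so for fixed c > 1 the admissible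
β₂ correspond bijectively to m in (0,1), with explicit inverse `beta2`. The period then separates:
T_φ = 8 √(c/(c-1)) · S(m), where S = `scaledK` is (1-m+m²)^(1/4) K (`periodFun_eq`).

S increases from π/2 at m = 0 to ∞ as m → 1, with positive derivative on (0,1)
(`exists_hasDerivAt_scaledK_pos`, `exists_lt_scaledK`). Hence T_φ = L has exactly one solution when
L / (8 √(c/(c-1))) > π/2, which for c > 1 is the condition c > L²/(L²-16π²). This gives one global
curve Λ, smooth by the implicit function theorem and unique separately at each c. The local
assertions are restrictions of the global ones.

The wave is ψ² with ψ = β₂ + (β₃-β₂) cn². Since cψ'² = (ψ-β₁)(ψ-β₂)(β₃-ψ)/5, the differential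
equation reduces to the relations between the roots (`isPositiveSolution_wave`). Elliptic integrals
depend smoothly on parameter and argument by differentiation under the integral sign, the amplitude
by implicit inversion. Joint smoothness in (c, x) becomes smoothness in the Fréchet space because
difference quotients in c of all x-derivatives converge uniformly on compact sets
(`eventually_slope_sub_lt`). -/

theorem hasFDerivAt_integral_of_contDiffOn {E F : Type*} [NormedAddCommGroup E] [NormedSpace ℝ E]
    [ProperSpace E] [NormedAddCommGroup F] [NormedSpace ℝ F] [CompleteSpace F]
    {U : Set E} (hU : IsOpen U) {f : E × ℝ → F} (hf : ContDiffOn ℝ 1 f (U ×ˢ univ))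
    (a b : ℝ) {x : E} (hx : x ∈ U) :
    HasFDerivAt (fun x => ∫ t in a..b, f (x, t))
      (∫ t in a..b, (fderiv ℝ f (x, t)).comp (ContinuousLinearMap.inl ℝ E ℝ)) x := by
  have hO : IsOpen (U ×ˢ (univ : Set ℝ)) := hU.prod isOpen_univ
  have hcf : ContinuousOn (fun p => (fderiv ℝ f p).comp (ContinuousLinearMap.inl ℝ E ℝ))
      (U ×ˢ univ) :=
    (hf.continuousOn_fderiv_of_isOpen hO le_rfl).clm_comp continuousOn_const
  -- Properness makes the closed ball compact, so the continuous partial derivative is bounded on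
  -- ball × [a, b]; this constant is the dominating function.
  obtain ⟨ε, hε, hεU⟩ := Metric.nhds_basis_closedBall.mem_iff.1 (hU.mem_nhds hx)
  obtain ⟨C, hC⟩ := ((isCompact_closedBall x ε).prod (isCompact_uIcc (a := a) (b := b))).exists_bound_of_continuousOn
      (hcf.mono (prod_mono hεU (subset_univ _)))
  have hline : ∀ y ∈ U, Continuous fun t : ℝ => f (y, t) := fun y hy =>
    hf.continuousOn.comp_continuous (by fun_prop) fun t => ⟨hy, mem_univ _⟩
  have hline' : Continuous fun t : ℝ =>
      (fderiv ℝ f (x, t)).comp (ContinuousLinearMap.inl ℝ E ℝ) :=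
    hcf.comp_continuous (f := fun t : ℝ => (x, t)) (by fun_prop) fun t => ⟨hx, mem_univ _⟩
  refine hasFDerivAt_integral_of_dominated_of_fderiv_le''
    (s := Metric.closedBall x ε) (bound := fun _ => C)
    (F := fun x t => f (x, t))
    (F' := fun x t => (fderiv ℝ f (x, t)).comp (ContinuousLinearMap.inl ℝ E ℝ))
    (Metric.closedBall_mem_nhds x hε) ?_ ?_ ?_ ?_ ?_ ?_
  · filter_upwards [hU.mem_nhds hx] with y hy
    exact (hline y hy).aestronglyMeasurable
  · exact (hline x hx).intervalIntegrable _ _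
  · exact hline'.aestronglyMeasurable
  · refine (MeasureTheory.ae_restrict_mem measurableSet_uIoc).mono fun t ht y hy => ?_
    exact hC (y, t) ⟨hy, uIoc_subset_uIcc ht⟩
  · exact intervalIntegrable_const
  · refine Eventually.of_forall fun t y hy => ?_
    have h1 : HasFDerivAt f (fderiv ℝ f (y, t)) (y, t) :=
      ((hf.contDiffAt (hO.mem_nhds ⟨hεU hy, mem_univ _⟩)).differentiableAt one_ne_zero).hasFDerivAt
    exact h1.comp y (hasFDerivAt_prodMk_left y t)

/-- The derivative of the integral is an integral of the same kind with values in `E →L[ℝ] F`. The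
induction on `n` must therefore vary `F`, and `E : Type` keeps this new codomain in `Type`. -/
theorem contDiffOn_integral_nat {E : Type} [NormedAddCommGroup E] [NormedSpace ℝ E]
    [ProperSpace E] {U : Set E} (hU : IsOpen U) (a b : ℝ) (n : ℕ) :
    ∀ {F : Type} [NormedAddCommGroup F] [NormedSpace ℝ F] [CompleteSpace F]
      {f : E × ℝ → F}, ContDiffOn ℝ n f (U ×ˢ univ) →
      ContDiffOn ℝ n (fun x => ∫ t in a..b, f (x, t)) U := by
  have hO : IsOpen (U ×ˢ (univ : Set ℝ)) := hU.prod isOpen_univ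
  induction n with
  | zero =>
    intro F _ _ _ f hf
    simp only [Nat.cast_zero, contDiffOn_zero] at hf ⊢
    intro x hx
    refine ContinuousAt.continuousWithinAt ?_
    obtain ⟨ε, hε, hεU⟩ := Metric.nhds_basis_closedBall.mem_iff.1 (hU.mem_nhds hx)
    obtain ⟨C, hC⟩ := ((isCompact_closedBall x ε).prod (isCompact_uIcc (a := a) (b := b))).exists_bound_of_continuousOn
      (hf.mono (prod_mono hεU (subset_univ _)))
    refine intervalIntegral.continuousAt_of_dominated_interval (bound := fun _ => C) ?_ ?_ ?_ ?_
    · filter_upwards [hU.mem_nhds hx] with y hy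
      exact (hf.comp_continuous (f := fun t : ℝ => (y, t)) (by fun_prop)
        fun t => ⟨hy, mem_univ _⟩).aestronglyMeasurable
    · filter_upwards [Metric.closedBall_mem_nhds x hε] with y hy
      refine Eventually.of_forall fun t ht => ?_
      exact hC (y, t) ⟨hy, uIoc_subset_uIcc ht⟩
    · exact intervalIntegrable_const
    · refine Eventually.of_forall fun t _ => ?_
      exact (hf.continuousAt (hO.mem_nhds ⟨hx, mem_univ t⟩)).comp
        (f := fun y : E => (y, t)) (by fun_prop)
  | succ n ih =>
    intro F _ _ _ f hf
    have hf1 : ContDiffOn ℝ 1 f (U ×ˢ univ) := hf.of_le (by exact_mod_cast Nat.le_add_left 1 n)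
    have hd := fun x hx => hasFDerivAt_integral_of_contDiffOn hU hf1 a b (x := x) hx
    rw [Nat.cast_add, Nat.cast_one, contDiffOn_succ_iff_fderiv_of_isOpen hU]
    refine ⟨fun x hx => (hd x hx).differentiableAt.differentiableWithinAt, by simp, ?_⟩
    refine ContDiffOn.congr (ih
      (f := fun p => (fderiv ℝ f p).comp (ContinuousLinearMap.inl ℝ E ℝ)) ?_)
      fun x hx => (hd x hx).fderiv
    refine ContDiffOn.clm_comp ?_ contDiffOn_const
    rw [Nat.cast_add, Nat.cast_one, contDiffOn_succ_iff_fderiv_of_isOpen hO] at hf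
    exact hf.2.2

theorem contDiffOn_integral {E F : Type} [NormedAddCommGroup E] [NormedSpace ℝ E]
    [ProperSpace E] [NormedAddCommGroup F] [NormedSpace ℝ F] [CompleteSpace F]
    {U : Set E} (hU : IsOpen U) {f : E × ℝ → F} (hf : ContDiffOn ℝ ∞ f (U ×ˢ univ))
    (a b : ℝ) :
    ContDiffOn ℝ ∞ (fun x => ∫ t in a..b, f (x, t)) U :=
  contDiffOn_infty.2 fun n => contDiffOn_integral_nat hU a b n (contDiffOn_infty.1 hf n)

/-- A function that is singled out by an equation with non-vanishing partial derivative is as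
smooth as the equation. -/
theorem contDiffAt_of_implicit {E : Type*} [NormedAddCommGroup E] [NormedSpace ℝ E]
    [CompleteSpace E] {n : ℕ∞ω} {f : E × ℝ → ℝ} {g : E → ℝ} {e : E} {S : Set ℝ}
    (hf : ContDiffAt ℝ n f (e, g e)) (hn : n ≠ 0) {d : ℝ}
    (hd : HasDerivAt (fun y => f (e, y)) d (g e)) (hd0 : d ≠ 0) (hS : S ∈ 𝓝 (g e))
    (huniq : ∀ᶠ x in 𝓝 e, ∀ y ∈ S, f (x, y) = f (e, g e) → y = g x) :
    ContDiffAt ℝ n g e := by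
  have hfd : HasFDerivAt f (fderiv ℝ f (e, g e)) (e, g e) :=
    (hf.differentiableAt hn).hasFDerivAt
  have hinr := hfd.comp (g e) (hasFDerivAt_prodMk_right e (g e))
  have heq : fderiv ℝ f (e, g e) ∘L .inr ℝ E ℝ =
      (ContinuousLinearEquiv.unitsEquivAut ℝ (Units.mk0 d hd0) : ℝ →L[ℝ] ℝ) := by
    rw [hinr.unique hd.hasFDerivAt]
    ext
    simp
  have hinv : (fderiv ℝ f (e, g e) ∘L .inr ℝ E ℝ).IsInvertible := ⟨_, heq.symm⟩
  have hψ := hf.contDiffAt_implicitFunction hn hinv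
  have hself : hf.implicitFunction hn hinv e = g e := hf.implicitFunction_apply_self hn hinv
  refine hψ.congr_of_eventuallyEq ?_
  -- Uniqueness of the solution is assumed only inside `S`; by continuity the implicit function
  -- stays there near `e`.
  have hmem : ∀ᶠ x in 𝓝 e, hf.implicitFunction hn hinv x ∈ S :=
    hψ.continuousAt.eventually_mem (by rwa [hself])
  filter_upwards [huniq, hmem, hf.eventually_apply_implicitFunction hn hinv] with x h1 h2 h3
  exact (h1 _ h2 h3).symm

/-! ### Smooth curves of periodic functions -/

/-- The derivative of `h` in the direction `v`, as a function of the base point. -/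
noncomputable def dirDeriv (v : ℝ × ℝ) (h : ℝ × ℝ → ℝ) (p : ℝ × ℝ) : ℝ := fderiv ℝ h p v

theorem contDiffOn_dirDeriv {U : Set (ℝ × ℝ)} (hU : IsOpen U) (v : ℝ × ℝ) {h : ℝ × ℝ → ℝ}
    (hh : ContDiffOn ℝ ∞ h U) : ContDiffOn ℝ ∞ (dirDeriv v h) U :=
  ((contDiffOn_infty_iff_fderiv_of_isOpen hU).1 hh).2.clm_apply contDiffOn_const

theorem contDiffOn_iterate_dirDeriv {U : Set (ℝ × ℝ)} (hU : IsOpen U) (v : ℝ × ℝ)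
    {h : ℝ × ℝ → ℝ} (hh : ContDiffOn ℝ ∞ h U) (n : ℕ) :
    ContDiffOn ℝ ∞ ((dirDeriv v)^[n] h) U := by
  induction n with
  | zero => exact hh
  | succ n ih =>
    rw [Function.iterate_succ_apply']
    exact contDiffOn_dirDeriv hU v ih

theorem dirDeriv_congr {U : Set (ℝ × ℝ)} (hU : IsOpen U) (v : ℝ × ℝ) {h₁ h₂ : ℝ × ℝ → ℝ}
    (hh : EqOn h₁ h₂ U) : EqOn (dirDeriv v h₁) (dirDeriv v h₂) U := fun p hp => by
  rw [dirDeriv, dirDeriv, (hh.eventuallyEq_of_mem (hU.mem_nhds hp)).fderiv_eq]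

theorem dirDeriv_comm {U : Set (ℝ × ℝ)} (hU : IsOpen U) (v w : ℝ × ℝ) {h : ℝ × ℝ → ℝ}
    (hh : ContDiffOn ℝ ∞ h U) : EqOn (dirDeriv v (dirDeriv w h)) (dirDeriv w (dirDeriv v h)) U := by
  intro p hp
  have hp' := hh.contDiffAt (hU.mem_nhds hp)
  have hd : DifferentiableAt ℝ (fderiv ℝ h) p :=
    (((contDiffOn_infty_iff_fderiv_of_isOpen hU).1 hh).2.contDiffAt
      (hU.mem_nhds hp)).differentiableAt (by simp)
  have key : ∀ a b : ℝ × ℝ, dirDeriv a (dirDeriv b h) p = fderiv ℝ (fderiv ℝ h) p a b := by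
    intro a b
    have := (hd.hasFDerivAt.clm_apply (hasFDerivAt_const b p)).fderiv
    simp [dirDeriv] at this ⊢
    change fderiv ℝ (fun y => fderiv ℝ h y b) p a = _
    rw [this]
    simp
  rw [key, key]
  exact (hp'.isSymmSndFDerivAt (by
    rw [minSmoothness_of_isRCLikeNormedField]; exact ENat.LEInfty.out)).eq v w

/-- By symmetry of second derivatives. It lets the parameter derivative pass through the
x-derivatives that define the seminorms. -/
theorem dirDeriv_iterate_comm {U : Set (ℝ × ℝ)} (hU : IsOpen U) (v w : ℝ × ℝ) {h : ℝ × ℝ → ℝ}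
    (hh : ContDiffOn ℝ ∞ h U) (n : ℕ) :
    EqOn (dirDeriv v ((dirDeriv w)^[n] h)) ((dirDeriv w)^[n] (dirDeriv v h)) U := by
  induction n with
  | zero => exact fun _ _ => rfl
  | succ n ih =>
    rw [Function.iterate_succ_apply', Function.iterate_succ_apply']
    exact (dirDeriv_comm hU v w (contDiffOn_iterate_dirDeriv hU w hh n)).trans
      (dirDeriv_congr hU w ih)

section Strip

variable {J : Set ℝ}

theorem hasDerivAt_dirDeriv_fst (hJ : IsOpen J) {h : ℝ × ℝ → ℝ}
    (hh : ContDiffOn ℝ ∞ h (J ×ˢ univ)) {c : ℝ} (hc : c ∈ J) (x : ℝ) :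
    HasDerivAt (fun c => h (c, x)) (dirDeriv (1, 0) h (c, x)) c := by
  have hd : HasFDerivAt h (fderiv ℝ h (c, x)) (c, x) :=
    ((hh.contDiffAt ((hJ.prod isOpen_univ).mem_nhds ⟨hc, mem_univ _⟩)).differentiableAt
      (by simp)).hasFDerivAt
  exact hd.comp_hasDerivAt c ((hasDerivAt_id c).prodMk (hasDerivAt_const c x))

theorem hasDerivAt_dirDeriv_snd (hJ : IsOpen J) {h : ℝ × ℝ → ℝ}
    (hh : ContDiffOn ℝ ∞ h (J ×ˢ univ)) {c : ℝ} (hc : c ∈ J) (x : ℝ) :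
    HasDerivAt (fun x => h (c, x)) (dirDeriv (0, 1) h (c, x)) x := by
  have hd : HasFDerivAt h (fderiv ℝ h (c, x)) (c, x) :=
    ((hh.contDiffAt ((hJ.prod isOpen_univ).mem_nhds ⟨hc, mem_univ _⟩)).differentiableAt
      (by simp)).hasFDerivAt
  exact hd.comp_hasDerivAt x ((hasDerivAt_const x c).prodMk (hasDerivAt_id x))

theorem iteratedDeriv_eq_dirDeriv (hJ : IsOpen J) {h : ℝ × ℝ → ℝ}
    (hh : ContDiffOn ℝ ∞ h (J ×ˢ univ)) {c : ℝ} (hc : c ∈ J) (j : ℕ) :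
    iteratedDeriv j (fun x => h (c, x)) = fun x => (dirDeriv (0, 1))^[j] h (c, x) := by
  induction j with
  | zero => simp
  | succ j ih =>
    rw [iteratedDeriv_succ, ih]
    ext x
    rw [Function.iterate_succ_apply']
    exact (hasDerivAt_dirDeriv_snd hJ
      (contDiffOn_iterate_dirDeriv (hJ.prod isOpen_univ) _ hh j) hc x).deriv

theorem periodic_dirDeriv (hJ : IsOpen J) {h : ℝ × ℝ → ℝ} {L : ℝ} (v : ℝ × ℝ)
    (hper : ∀ c ∈ J, Function.Periodic (fun x => h (c, x)) L) :
    ∀ c ∈ J, Function.Periodic (fun x => dirDeriv v h (c, x)) L := by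
  intro c hc x
  -- Periodicity holds only over `J`, but the strip is open, so `h` agrees with its translate near
  -- the point and the derivatives agree too.
  have heq : (fun p : ℝ × ℝ => h (p + (0, L))) =ᶠ[𝓝 (c, x)] h := by
    filter_upwards [(hJ.prod isOpen_univ).mem_nhds ⟨hc, mem_univ x⟩] with p hp
    have := hper p.1 hp.1 p.2
    simpa [Prod.add_def] using this
  have := heq.fderiv_eq (𝕜 := ℝ)
  rw [fderiv_comp_add_right (𝕜 := ℝ) (f := h) (0, L)] at this
  simp only [dirDeriv]
  rw [← this]
  simp

theorem periodic_iterate_dirDeriv (hJ : IsOpen J) {h : ℝ × ℝ → ℝ} {L : ℝ} (v : ℝ × ℝ)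
    (hper : ∀ c ∈ J, Function.Periodic (fun x => h (c, x)) L) (n : ℕ) :
    ∀ c ∈ J, Function.Periodic (fun x => (dirDeriv v)^[n] h (c, x)) L := by
  induction n with
  | zero => exact hper
  | succ n ih =>
    rw [Function.iterate_succ_apply']
    exact periodic_dirDeriv hJ v ih

/-- Difference quotients in the parameter converge uniformly on compact intervals. -/
theorem eventually_slope_sub_lt (hJ : IsOpen J) {h : ℝ × ℝ → ℝ}
    (hh : ContDiffOn ℝ ∞ h (J ×ˢ univ)) {c : ℝ} (hc : c ∈ J) (L : ℝ) {ε : ℝ} (hε : 0 < ε) :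
    ∀ᶠ c' in 𝓝[≠] c, ∀ x ∈ Icc (0 : ℝ) L,
      |(c' - c)⁻¹ * (h (c', x) - h (c, x)) - dirDeriv (1, 0) h (c, x)| < ε := by
  have hO : IsOpen (J ×ˢ (univ : Set ℝ)) := hJ.prod isOpen_univ
  have hG : ContinuousOn (dirDeriv (1, 0) h) (J ×ˢ univ) :=
    (contDiffOn_dirDeriv hO (1, 0) hh).continuousOn
  have hev : ∀ᶠ c' in 𝓝 c, ∀ x ∈ Icc (0 : ℝ) L,
      |dirDeriv (1, 0) h (c', x) - dirDeriv (1, 0) h (c, x)| < ε / 2 := by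
    refine isCompact_Icc.eventually_forall_of_forall_eventually fun x _ => ?_
    have hc1 : ContinuousAt (dirDeriv (1, 0) h) (c, x) :=
      hG.continuousAt (hO.mem_nhds ⟨hc, mem_univ x⟩)
    have hc2 : ContinuousAt (fun p : ℝ × ℝ => dirDeriv (1, 0) h (c, p.2)) (c, x) :=
      ContinuousAt.comp (f := fun p : ℝ × ℝ => (c, p.2)) (x := (c, x)) hc1 (by fun_prop)
    have hc3 := (hc1.sub hc2).abs
    refine hc3.eventually_lt continuousAt_const ?_
    simpa using half_pos hε
  obtain ⟨δ, hδ, hball⟩ := Metric.eventually_nhds_iff_ball.1 (hev.and (hJ.mem_nhds hc))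
  filter_upwards [nhdsWithin_le_nhds (Metric.ball_mem_nhds c hδ), self_mem_nhdsWithin]
    with c' hc' hne x hx
  -- Mean value inequality after subtracting the linear term: the derivative of the remainder is at
  -- most ε/2 on the ball, for every `x` in the compact interval at once.
  have hmv := (convex_ball c δ).norm_image_sub_le_of_norm_hasDerivWithin_le
    (f := fun s => h (s, x) - s * dirDeriv (1, 0) h (c, x))
    (f' := fun s => dirDeriv (1, 0) h (s, x) - 1 * dirDeriv (1, 0) h (c, x)) (C := ε / 2)
    (fun s hs => ((hasDerivAt_dirDeriv_fst hJ hh (hball s hs).2 x).sub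
      ((hasDerivAt_id s).mul_const _)).hasDerivWithinAt)
    (fun s hs => by simpa using ((hball s hs).1 x hx).le) (Metric.mem_ball_self hδ) hc'
  have hne' : c' - c ≠ 0 := sub_ne_zero.2 hne
  have hpos : 0 < |c' - c| := abs_pos.2 hne'
  have heq : (c' - c)⁻¹ * (h (c', x) - h (c, x)) - dirDeriv (1, 0) h (c, x) =
      (c' - c)⁻¹ * ((h (c', x) - c' * dirDeriv (1, 0) h (c, x)) -
        (h (c, x) - c * dirDeriv (1, 0) h (c, x))) := by
    field_simp
    ring
  rw [heq, abs_mul, abs_inv]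
  rw [Real.norm_eq_abs, Real.norm_eq_abs] at hmv
  calc |c' - c|⁻¹ * _ ≤ |c' - c|⁻¹ * (ε / 2 * |c' - c|) := by gcongr
    _ = ε / 2 := by field_simp
    _ < ε := half_lt_self hε

/-- A jointly smooth family of periodic functions is a smooth curve in `C^∞_per`. -/
theorem exists_smoothCurveOn_of_contDiffOn (hJ : IsOpen J) {f : ℝ × ℝ → ℝ} {L : ℝ}
    (hf : ContDiffOn ℝ ∞ f (J ×ˢ univ))
    (hper : ∀ c ∈ J, Function.Periodic (fun x => f (c, x)) L) :
    ∃ Φ : ℝ → CinfPer L, (∀ c ∈ J, (Φ c).toFun = fun x => f (c, x)) ∧ SmoothCurveOn Φ J := by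
  classical
  have hO : IsOpen (J ×ˢ (univ : Set ℝ)) := hJ.prod isOpen_univ
  have hsm : ∀ n, ContDiffOn ℝ ∞ ((dirDeriv (1, 0))^[n] f) (J ×ˢ univ) :=
    contDiffOn_iterate_dirDeriv hO _ hf
  have hmem : ∀ n, ∀ c ∈ J, (fun x => (dirDeriv (1, 0))^[n] f (c, x)) ∈ perSubmodule L :=
    fun n c hc => ⟨contDiff_iff_contDiffAt.2 fun x =>
      ((hsm n).contDiffAt (hO.mem_nhds ⟨hc, mem_univ x⟩)).comp (f := fun x : ℝ => (c, x)) x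
        (contDiffAt_const.prodMk contDiffAt_id), periodic_iterate_dirDeriv hJ _ hper n c hc⟩
  let g : ℕ → ℝ → CinfPer L := fun n c =>
    if hc : c ∈ J then (⟨_, hmem n c hc⟩ : perSubmodule L) else (0 : perSubmodule L)
  have hg : ∀ n, ∀ c ∈ J, (g n c).1 = fun x => (dirDeriv (1, 0))^[n] f (c, x) := by
    intro n c hc
    have : g n c = (⟨_, hmem n c hc⟩ : perSubmodule L) := dif_pos hc
    rw [this]
  refine ⟨g 0, fun c hc => hg 0 c hc, g, fun _ _ => rfl, fun n c hc => ?_⟩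
  rw [(CinfPer.withSeminorms L).tendsto_nhds]
  intro j ε hε
  have hD := contDiffOn_iterate_dirDeriv hO (0, 1) (hsm n) j
  filter_upwards [eventually_slope_sub_lt hJ hD hc L hε,
    nhdsWithin_le_nhds (hJ.mem_nhds hc)] with c' hc' hcJ
  change ‖CinfPer.derivL L j (slope (g n) c c' - g (n + 1) c)‖ < ε
  rw [slope_def_module, map_sub, map_smul, map_sub, ContinuousMap.norm_lt_iff _ hε]
  intro x
  have hval : ∀ m, ∀ s ∈ J, CinfPer.derivL L j (g m s) x =
      (dirDeriv (0, 1))^[j] ((dirDeriv (1, 0))^[m] f) (s, (x : ℝ)) := by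
    intro m s hs
    change iteratedDeriv j (g m s).1 x = _
    rw [hg m s hs, iteratedDeriv_eq_dirDeriv hJ (hsm m) hs]
  have hcomm : (dirDeriv (0, 1))^[j] ((dirDeriv (1, 0))^[n + 1] f) (c, (x : ℝ)) =
      dirDeriv (1, 0) ((dirDeriv (0, 1))^[j] ((dirDeriv (1, 0))^[n] f)) (c, (x : ℝ)) := by
    rw [Function.iterate_succ_apply']
    exact (dirDeriv_iterate_comm hO (1, 0) (0, 1) (hsm n) j ⟨hc, mem_univ _⟩).symm
  have := hc' x x.2
  rw [← hcomm] at this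
  simpa [hval n c' hcJ, hval n c hc, hval (n + 1) c hc] using this

end Strip

/-! ### Elliptic integrals and functions in terms of the parameter `m = k²` -/

/-- The incomplete elliptic integral of the first kind with parameter `m = k²`. -/
noncomputable def ellF (m θ : ℝ) : ℝ := ∫ t in (0 : ℝ)..θ, 1 / √(1 - m * Real.sin t ^ 2)

/-- The Jacobi amplitude with parameter `m = k²`. -/
noncomputable def ellAm (m u : ℝ) : ℝ := Function.invFun (ellF m) u

theorem ellipticK_eq (k : ℝ) : ellipticK k = ellF (k ^ 2) (Real.pi / 2) := rfl

theorem jacobiCN_eq (u k : ℝ) : jacobiCN u k = Real.cos (ellAm (k ^ 2) u) := rfl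

theorem one_sub_mul_sin_sq_pos {m : ℝ} (hm : m < 1) (t : ℝ) : 0 < 1 - m * Real.sin t ^ 2 := by
  have h1 := Real.sin_sq_le_one t
  have h2 := sq_nonneg (Real.sin t)
  rcases h2.eq_or_lt with h | h
  · rw [← h]; norm_num
  · nlinarith

theorem continuous_ellF_integrand {m : ℝ} (hm : m < 1) :
    Continuous fun t : ℝ => 1 / √(1 - m * Real.sin t ^ 2) :=
  continuous_const.div (by fun_prop) fun t => (Real.sqrt_pos.2 (one_sub_mul_sin_sq_pos hm t)).ne'

theorem hasDerivAt_ellF {m : ℝ} (hm : m < 1) (θ : ℝ) :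
    HasDerivAt (ellF m) (1 / √(1 - m * Real.sin θ ^ 2)) θ :=
  ((continuous_ellF_integrand hm).integral_hasStrictDerivAt 0 θ).hasDerivAt

theorem continuous_ellF {m : ℝ} (hm : m < 1) : Continuous (ellF m) :=
  continuous_iff_continuousAt.2 fun θ => (hasDerivAt_ellF hm θ).continuousAt

theorem ellF_zero (m : ℝ) : ellF m 0 = 0 := by simp [ellF]

theorem strictMono_ellF {m : ℝ} (hm : m < 1) : StrictMono (ellF m) := by
  refine strictMono_of_deriv_pos fun θ => ?_
  rw [(hasDerivAt_ellF hm θ).deriv]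
  have := Real.sqrt_pos.2 (one_sub_mul_sin_sq_pos hm θ)
  positivity

/-- The substitution t = θs fixes the interval of integration, turning the endpoint into another
parameter of the integrand. -/
theorem contDiffOn_ellF :
    ContDiffOn ℝ ∞ (fun p : ℝ × ℝ => ellF p.1 p.2) (Iio 1 ×ˢ univ) := by
  have heq : ∀ p : ℝ × ℝ, ellF p.1 p.2 =
      ∫ s in (0 : ℝ)..1, p.2 * (1 / √(1 - p.1 * Real.sin (p.2 * s) ^ 2)) := by
    intro p
    rw [intervalIntegral.integral_const_mul, intervalIntegral.mul_integral_comp_mul_left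
      (f := fun t => 1 / √(1 - p.1 * Real.sin t ^ 2))]
    simp [ellF]
  refine ContDiffOn.congr (contDiffOn_integral (isOpen_Iio.prod isOpen_univ)
    (f := fun q : (ℝ × ℝ) × ℝ => q.1.2 * (1 / √(1 - q.1.1 * Real.sin (q.1.2 * q.2) ^ 2)))
    ?_ 0 1) fun p _ => heq p
  have hW : ∀ q ∈ ((Iio (1 : ℝ) ×ˢ univ) ×ˢ univ : Set ((ℝ × ℝ) × ℝ)),
      0 < 1 - q.1.1 * Real.sin (q.1.2 * q.2) ^ 2 := fun q hq =>
    one_sub_mul_sin_sq_pos hq.1.1 _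
  refine ContDiffOn.mul (by fun_prop) (ContDiffOn.div contDiffOn_const
    (ContDiffOn.sqrt ?_ fun q hq => (hW q hq).ne') fun q hq => (Real.sqrt_pos.2 (hW q hq)).ne')
  exact ContDiff.contDiffOn (contDiff_const.sub ((contDiff_fst.comp contDiff_fst).mul
    ((Real.contDiff_sin.comp ((contDiff_snd.comp contDiff_fst).mul contDiff_snd)).pow 2)))

theorem ellF_neg (m θ : ℝ) : ellF m (-θ) = -ellF m θ := by
  have := intervalIntegral.integral_comp_neg (a := 0) (b := θ)
    (fun t => 1 / √(1 - m * Real.sin t ^ 2))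
  simp only [Real.sin_neg, neg_sq, neg_zero] at this
  rw [ellF, ellF, this, intervalIntegral.integral_symm]

/-- The integrand is π-periodic, so the increment is its integral over [-π/2, π/2], which is 2K by
evenness. -/
theorem ellF_add_pi {m : ℝ} (hm : m < 1) (θ : ℝ) :
    ellF m (θ + Real.pi) = ellF m θ + 2 * ellF m (Real.pi / 2) := by
  have hint : ∀ a b : ℝ, IntervalIntegrable (fun t => 1 / √(1 - m * Real.sin t ^ 2))
      MeasureTheory.volume a b := fun a b => (continuous_ellF_integrand hm).intervalIntegrable a b
  have hper : Function.Periodic (fun t => 1 / √(1 - m * Real.sin t ^ 2)) Real.pi := by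
    intro t
    simp [Real.sin_add_pi]
  have h1 := intervalIntegral.integral_add_adjacent_intervals (hint 0 θ) (hint θ (θ + Real.pi))
  have h2 := intervalIntegral.integral_add_adjacent_intervals (hint (-(Real.pi / 2)) 0)
    (hint 0 (Real.pi / 2))
  have h3 := hper.intervalIntegral_add_eq θ (-(Real.pi / 2))
  have h4 : -(Real.pi / 2) + Real.pi = Real.pi / 2 := by ring
  have h5 := ellF_neg m (Real.pi / 2)
  rw [ellF, intervalIntegral.integral_symm, neg_inj] at h5
  rw [h4] at h3
  rw [ellF, ← h1, h3, ← h2, h5, ellF, ellF]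
  ring

theorem tendsto_ellF_atTop {m : ℝ} (hm0 : 0 ≤ m) (hm : m < 1) : Tendsto (ellF m) atTop atTop := by
  refine tendsto_atTop_mono' _ ?_ tendsto_id
  filter_upwards [eventually_ge_atTop 0] with θ hθ
  have : ∫ _ in (0 : ℝ)..θ, (1 : ℝ) ≤ ellF m θ := by
    refine intervalIntegral.integral_mono_on hθ intervalIntegrable_const
      ((continuous_ellF_integrand hm).intervalIntegrable _ _) fun t _ => ?_
    rw [le_div_iff₀ (Real.sqrt_pos.2 (one_sub_mul_sin_sq_pos hm t)), one_mul]
    refine Real.sqrt_le_one.2 ?_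
    nlinarith [sq_nonneg (Real.sin t)]
  simpa using this

theorem surjective_ellF {m : ℝ} (hm0 : 0 ≤ m) (hm : m < 1) : Function.Surjective (ellF m) := by
  refine (continuous_ellF hm).surjective (tendsto_ellF_atTop hm0 hm) ?_
  have h := tendsto_neg_atTop_atBot.comp ((tendsto_ellF_atTop hm0 hm).comp tendsto_neg_atBot_atTop)
  refine h.congr fun θ => ?_
  simp [ellF_neg]

theorem ellAm_ellF {m : ℝ} (hm : m < 1) (θ : ℝ) : ellAm m (ellF m θ) = θ :=
  Function.leftInverse_invFun (strictMono_ellF hm).injective θ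

theorem ellF_ellAm {m : ℝ} (hm0 : 0 ≤ m) (hm : m < 1) (u : ℝ) : ellF m (ellAm m u) = u :=
  Function.rightInverse_invFun (surjective_ellF hm0 hm) u

theorem ellAm_zero {m : ℝ} (hm : m < 1) : ellAm m 0 = 0 := by
  simpa [ellF_zero] using ellAm_ellF hm 0

theorem ellAm_add {m : ℝ} (hm0 : 0 ≤ m) (hm : m < 1) (u : ℝ) :
    ellAm m (u + 2 * ellF m (Real.pi / 2)) = ellAm m u + Real.pi := by
  apply (strictMono_ellF hm).injective
  rw [ellF_ellAm hm0 hm, ellF_add_pi hm, ellF_ellAm hm0 hm]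

/-- The amplitude is the only solution y of F(m, y) = u, and ∂F/∂y > 0. Injectivity is global, so no
localisation in y is needed. -/
theorem contDiffOn_ellAm :
    ContDiffOn ℝ ∞ (fun p : ℝ × ℝ => ellAm p.1 p.2) (Ioo 0 1 ×ˢ univ) := by
  rintro ⟨m, u⟩ ⟨hm, -⟩
  refine ContDiffAt.contDiffWithinAt ?_
  have hF : ContDiffAt ℝ ∞ (fun p : ℝ × ℝ => ellF p.1 p.2) (m, ellAm m u) :=
    contDiffOn_ellF.contDiffAt ((isOpen_Iio.prod isOpen_univ).mem_nhds ⟨hm.2, mem_univ _⟩)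
  refine contDiffAt_of_implicit (S := univ)
    (f := fun q : (ℝ × ℝ) × ℝ => ellF q.1.1 q.2 - q.1.2)
    (d := 1 / √(1 - m * Real.sin (ellAm m u) ^ 2))
    ?_ (by simp) ?_ ?_ univ_mem ?_
  · refine ContDiffAt.sub ?_ (by fun_prop)
    exact ContDiffAt.comp (g := fun p : ℝ × ℝ => ellF p.1 p.2)
      (f := fun q : (ℝ × ℝ) × ℝ => (q.1.1, q.2)) ((m, u), ellAm m u) hF (by fun_prop)
  · exact (hasDerivAt_ellF hm.2 _).sub_const _
  · exact (one_div_pos.2 (Real.sqrt_pos.2 (one_sub_mul_sin_sq_pos hm.2 _))).ne'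
  · filter_upwards [(isOpen_Ioo.prod isOpen_univ).mem_nhds (⟨hm, mem_univ _⟩ :
      (m, u) ∈ Ioo (0 : ℝ) 1 ×ˢ (univ : Set ℝ))] with p hp y _ hy
    simp only [ellF_ellAm hm.1.le hm.2, sub_self, sub_eq_zero] at hy
    rw [← hy, ellAm_ellF hp.1.2]

theorem hasDerivAt_ellAm {m : ℝ} (hm : m ∈ Ioo (0 : ℝ) 1) (u : ℝ) :
    HasDerivAt (ellAm m) (√(1 - m * Real.sin (ellAm m u) ^ 2)) u := by
  have hc : ContinuousAt (ellAm m) u :=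
    (contDiffOn_ellAm.contDiffAt ((isOpen_Ioo.prod isOpen_univ).mem_nhds
      (⟨hm, mem_univ u⟩ : (m, u) ∈ Ioo (0 : ℝ) 1 ×ˢ (univ : Set ℝ)))).continuousAt.comp
      (f := fun u : ℝ => (m, u)) (by fun_prop)
  have := HasDerivAt.of_local_left_inverse hc (hasDerivAt_ellF hm.2 (ellAm m u))
    (one_div_pos.2 (Real.sqrt_pos.2 (one_sub_mul_sin_sq_pos hm.2 _))).ne'
    (Eventually.of_forall fun y => ellF_ellAm hm.1.le hm.2 y)
  simpa using this

/-! ### Monotonicity of the scaled complete elliptic integral -/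

/-- The complete elliptic integral scaled by `(1 - m + m²)^(1/4)`. -/
noncomputable def scaledK (m : ℝ) : ℝ := (1 - m + m ^ 2) ^ (1 / 4 : ℝ) * ellF m (Real.pi / 2)

theorem one_sub_add_sq_pos (m : ℝ) : 0 < 1 - m + m ^ 2 := by nlinarith [sq_nonneg (m - 1 / 2)]

theorem contDiffOn_scaledK : ContDiffOn ℝ ∞ scaledK (Iio 1) := by
  refine ContDiffOn.mul (ContDiffOn.rpow_const_of_ne (by fun_prop)
    fun m _ => (one_sub_add_sq_pos m).ne') ?_
  exact contDiffOn_ellF.comp (f := fun m : ℝ => (m, Real.pi / 2)) (by fun_prop)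
    fun m hm => ⟨hm, mem_univ _⟩

theorem hasDerivAt_ellF_param {m : ℝ} (hm : m < 1) (θ : ℝ) :
    HasDerivAt (fun m => ellF m θ)
      (∫ t in (0 : ℝ)..θ, Real.sin t ^ 2 / 2 / √(1 - m * Real.sin t ^ 2) ^ 3) m := by
  have hW : ∀ p ∈ Iio (1 : ℝ) ×ˢ (univ : Set ℝ), 0 < 1 - p.1 * Real.sin p.2 ^ 2 :=
    fun p hp => one_sub_mul_sin_sq_pos hp.1 _
  have hf : ContDiffOn ℝ 1 (fun p : ℝ × ℝ => 1 / √(1 - p.1 * Real.sin p.2 ^ 2))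
      (Iio 1 ×ˢ univ) := by
    refine ContDiffOn.div contDiffOn_const (ContDiffOn.sqrt ?_ fun p hp => (hW p hp).ne')
      fun p hp => (Real.sqrt_pos.2 (hW p hp)).ne'
    exact ContDiff.contDiffOn (contDiff_const.sub (contDiff_fst.mul
      ((Real.contDiff_sin.comp contDiff_snd).pow 2)))
  have hO : IsOpen (Iio (1 : ℝ) ×ˢ (univ : Set ℝ)) := isOpen_Iio.prod isOpen_univ
  have hcf : Continuous (fun t : ℝ => (fderiv ℝ (fun p : ℝ × ℝ => 1 / √(1 - p.1 * Real.sin p.2 ^ 2))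
      (m, t)).comp (ContinuousLinearMap.inl ℝ ℝ ℝ)) :=
    ((hf.continuousOn_fderiv_of_isOpen hO le_rfl).clm_comp continuousOn_const).comp_continuous
      (f := fun t : ℝ => (m, t)) (by fun_prop) fun t => ⟨hm, mem_univ _⟩
  have h := (hasFDerivAt_integral_of_contDiffOn isOpen_Iio hf 0 θ (x := m) hm).hasDerivAt
  rw [ContinuousLinearMap.intervalIntegral_apply (hcf.intervalIntegrable _ _)] at h
  refine h.congr_deriv (intervalIntegral.integral_congr fun t _ => ?_)
  have hWt := one_sub_mul_sin_sq_pos hm t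
  have hd : HasFDerivAt (fun p : ℝ × ℝ => 1 / √(1 - p.1 * Real.sin p.2 ^ 2))
      (fderiv ℝ (fun p : ℝ × ℝ => 1 / √(1 - p.1 * Real.sin p.2 ^ 2)) (m, t)) (m, t) :=
    ((hf.contDiffAt (hO.mem_nhds (show (m, t) ∈ Iio (1 : ℝ) ×ˢ univ from
      ⟨hm, mem_univ _⟩))).differentiableAt one_ne_zero).hasFDerivAt
  have h1 := (hd.comp m (hasFDerivAt_prodMk_left m t)).hasDerivAt
  have h2 : HasDerivAt (fun m => 1 / √(1 - m * Real.sin t ^ 2))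
      (Real.sin t ^ 2 / 2 / √(1 - m * Real.sin t ^ 2) ^ 3) m := by
    have h3 := (((hasDerivAt_id m).mul_const (Real.sin t ^ 2)).const_sub 1).sqrt hWt.ne'
    have h4 := (hasDerivAt_const m (1 : ℝ)).div h3 (Real.sqrt_pos.2 hWt).ne'
    refine h4.congr_deriv ?_
    have := Real.sqrt_pos.2 hWt
    simp only [id]
    field_simp
    ring
  exact h1.unique h2

/-- The sign of `d/dm scaledK`, up to positive factors. The integrand is brought to a manifestly
positive form by subtracting the derivative of `sin t cos t / √(1 - m sin² t)`. -/
theorem integral_scaledK_deriv_pos {m : ℝ} (hm : m ∈ Ioo (0 : ℝ) 1) :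
    0 < (2 * m - 1) * ellF m (Real.pi / 2) + 4 * (1 - m + m ^ 2) *
      ∫ t in (0 : ℝ)..(Real.pi / 2), Real.sin t ^ 2 / 2 / √(1 - m * Real.sin t ^ 2) ^ 3 := by
  have hR : ∀ t : ℝ, 0 < √(1 - m * Real.sin t ^ 2) := fun t =>
    Real.sqrt_pos.2 (one_sub_mul_sin_sq_pos hm.2 t)
  have hR2 : ∀ t : ℝ, √(1 - m * Real.sin t ^ 2) ^ 2 = 1 - m * Real.sin t ^ 2 := fun t =>
    Real.sq_sqrt (one_sub_mul_sin_sq_pos hm.2 t).le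
  have hcont : ∀ P : ℝ → ℝ, Continuous P →
      Continuous fun t : ℝ => P t / √(1 - m * Real.sin t ^ 2) ^ 3 := fun P hP =>
    hP.div (by fun_prop) fun t => (pow_pos (hR t) 3).ne'
  have hpos : 0 < ∫ t in (0 : ℝ)..(Real.pi / 2),
      m * (2 - Real.sin t ^ 2 + Real.sin t ^ 4) / √(1 - m * Real.sin t ^ 2) ^ 3 := by
    refine intervalIntegral.intervalIntegral_pos_of_pos
      ((hcont _ (by fun_prop)).intervalIntegrable _ _) (fun t => ?_) (by positivity)
    have h1 : 0 < 2 - Real.sin t ^ 2 + Real.sin t ^ 4 := by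
      nlinarith [sq_nonneg (Real.sin t ^ 2 - 1 / 2)]
    exact div_pos (mul_pos hm.1 h1) (pow_pos (hR t) 3)
  have hzero : ∫ t in (0 : ℝ)..(Real.pi / 2),
      (1 - 2 * Real.sin t ^ 2 + m * Real.sin t ^ 4) / √(1 - m * Real.sin t ^ 2) ^ 3 = 0 := by
    rw [intervalIntegral.integral_eq_sub_of_hasDerivAt
      (f := fun t => Real.sin t * Real.cos t / √(1 - m * Real.sin t ^ 2)) ?_
      ((hcont _ (by fun_prop)).intervalIntegrable _ _)]
    · simp
    · intro t _
      have h3 := ((((Real.hasDerivAt_sin t).pow 2).const_mul m).const_sub 1).sqrt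
        (one_sub_mul_sin_sq_pos hm.2 t).ne'
      refine (((Real.hasDerivAt_sin t).mul (Real.hasDerivAt_cos t)).div h3 (hR t).ne').congr_deriv
        ?_
      have h4 := hR t
      have h5 := hR2 t
      have h6 := Real.cos_sq' t
      simp only [Pi.mul_apply, Pi.pow_apply, Nat.add_one_sub_one, pow_one, Nat.cast_ofNat]
      generalize √(1 - m * Real.sin t ^ 2) = R at h4 h5 ⊢
      field_simp
      linear_combination (Real.cos t ^ 2 - Real.sin t ^ 2) * h5 + h6
  have hsum : (2 * m - 1) * ellF m (Real.pi / 2) + 4 * (1 - m + m ^ 2) *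
      ∫ t in (0 : ℝ)..(Real.pi / 2), Real.sin t ^ 2 / 2 / √(1 - m * Real.sin t ^ 2) ^ 3 =
      (∫ t in (0 : ℝ)..(Real.pi / 2),
        m * (2 - Real.sin t ^ 2 + Real.sin t ^ 4) / √(1 - m * Real.sin t ^ 2) ^ 3) -
      ∫ t in (0 : ℝ)..(Real.pi / 2),
        (1 - 2 * Real.sin t ^ 2 + m * Real.sin t ^ 4) / √(1 - m * Real.sin t ^ 2) ^ 3 := by
    rw [ellF, ← intervalIntegral.integral_const_mul, ← intervalIntegral.integral_const_mul,
      ← intervalIntegral.integral_add, ← intervalIntegral.integral_sub]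
    · refine intervalIntegral.integral_congr fun t _ => ?_
      have h4 := hR t
      have h5 := hR2 t
      field_simp
      rw [h5]
      ring
    · exact (hcont (fun t => m * (2 - Real.sin t ^ 2 + Real.sin t ^ 4))
        (by fun_prop)).intervalIntegrable _ _
    · exact (hcont (fun t => 1 - 2 * Real.sin t ^ 2 + m * Real.sin t ^ 4)
        (by fun_prop)).intervalIntegrable _ _
    · exact ((continuous_ellF_integrand hm.2).intervalIntegrable _ _).const_mul (2 * m - 1)
    · exact ((hcont (fun t => Real.sin t ^ 2 / 2)
        (by fun_prop)).intervalIntegrable _ _).const_mul (4 * (1 - m + m ^ 2))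
  rw [hsum, hzero, sub_zero]
  exact hpos

theorem exists_hasDerivAt_scaledK_pos {m : ℝ} (hm : m ∈ Ioo (0 : ℝ) 1) :
    ∃ d, 0 < d ∧ HasDerivAt scaledK d m := by
  have hq := one_sub_add_sq_pos m
  have h1 : HasDerivAt (fun m : ℝ => 1 - m + m ^ 2) (2 * m - 1) m :=
    (((hasDerivAt_id m).const_sub 1).add ((hasDerivAt_id m).pow 2)).congr_deriv (by simp; ring)
  refine ⟨_, ?_, (h1.rpow_const (p := 1 / 4) (Or.inl hq.ne')).mul
    (hasDerivAt_ellF_param hm.2 (Real.pi / 2))⟩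
  -- Factoring (1-m+m²)^(-3/4)/4 out of the derivative leaves the expression of
  -- `integral_scaledK_deriv_pos`.
  have h2 : (1 - m + m ^ 2) ^ (1 / 4 : ℝ) =
      (1 - m + m ^ 2) ^ (1 / 4 - 1 : ℝ) * (1 - m + m ^ 2) := by
    rw [← Real.rpow_add_one hq.ne']
    norm_num
  have h3 := mul_pos (Real.rpow_pos_of_pos hq (1 / 4 - 1 : ℝ)) (integral_scaledK_deriv_pos hm)
  rw [h2]
  nlinarith [h3]

theorem strictMonoOn_scaledK : StrictMonoOn scaledK (Ico 0 1) := by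
  refine strictMonoOn_of_deriv_pos (convex_Ico 0 1)
    (contDiffOn_scaledK.continuousOn.mono fun m hm => hm.2) fun m hm => ?_
  rw [interior_Ico] at hm
  obtain ⟨d, hd, h⟩ := exists_hasDerivAt_scaledK_pos hm
  rwa [h.deriv]

theorem scaledK_zero : scaledK 0 = Real.pi / 2 := by
  simp [scaledK, ellF]

/-- With m = 1-ε², the radicand is cos² t + ε² sin² t ≤ (π/2 - t + ε)². Integrating the reciprocal
gives log((π/2+ε)/ε), and π/2 + ε ≥ 1. -/
theorem log_le_ellF {ε : ℝ} (hε : ε ∈ Ioo (0 : ℝ) 1) :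
    Real.log (1 / ε) ≤ ellF (1 - ε ^ 2) (Real.pi / 2) := by
  have hm : 1 - ε ^ 2 < 1 := by have := pow_pos hε.1 2; linarith
  have hpi := Real.pi_pos
  have hle : ∀ t ∈ Icc 0 (Real.pi / 2), 0 < Real.pi / 2 - t + ε := fun t ht => by
    linarith [ht.2, hε.1]
  have hc : ContinuousOn (fun t : ℝ => 1 / (Real.pi / 2 - t + ε)) (uIcc 0 (Real.pi / 2)) := by
    rw [uIcc_of_le (by positivity)]
    exact continuousOn_const.div (by fun_prop) fun t ht => (hle t ht).ne'
  have hint : ∫ t in (0 : ℝ)..(Real.pi / 2), 1 / (Real.pi / 2 - t + ε) =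
      -Real.log (Real.pi / 2 - Real.pi / 2 + ε) - -Real.log (Real.pi / 2 - 0 + ε) := by
    refine intervalIntegral.integral_eq_sub_of_hasDerivAt
      (f := fun t => -Real.log (Real.pi / 2 - t + ε)) (fun t ht => ?_) hc.intervalIntegrable
    rw [uIcc_of_le (by positivity)] at ht
    have := ((((hasDerivAt_id t).const_sub (Real.pi / 2)).add_const ε).log (hle t ht).ne').neg
    refine this.congr_deriv ?_
    simp [neg_div]
  have hmono : ∫ t in (0 : ℝ)..(Real.pi / 2), 1 / (Real.pi / 2 - t + ε) ≤
      ellF (1 - ε ^ 2) (Real.pi / 2) := by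
    refine intervalIntegral.integral_mono_on (by positivity) hc.intervalIntegrable
      ((continuous_ellF_integrand hm).intervalIntegrable _ _) fun t ht => ?_
    refine one_div_le_one_div_of_le (Real.sqrt_pos.2 (one_sub_mul_sin_sq_pos hm t)) ?_
    refine (Real.sqrt_le_left (hle t ht).le).2 ?_
    have h1 : Real.cos t ≤ Real.pi / 2 - t := by
      rw [← Real.sin_pi_div_two_sub]
      exact Real.sin_le (by linarith [ht.2])
    have h2 : 0 ≤ Real.cos t := Real.cos_nonneg_of_mem_Icc ⟨by linarith [ht.1], ht.2⟩
    have h3 := Real.sin_sq_add_cos_sq t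
    have h4 := Real.sin_sq_le_one t
    nlinarith [mul_nonneg (sub_nonneg.2 ht.2) hε.1.le, sq_nonneg ε,
      mul_le_mul h1 h1 h2 (by linarith)]
  refine le_trans ?_ hmono
  rw [hint, one_div, Real.log_inv]
  have : 0 ≤ Real.log (Real.pi / 2 - 0 + ε) :=
    Real.log_nonneg (by linarith [Real.pi_gt_three, hε.1])
  simp only [sub_self, zero_add]
  linarith

theorem exists_lt_scaledK {y : ℝ} (hy : 0 < y) : ∃ m ∈ Ioo (0 : ℝ) 1, y < scaledK m := by
  -- This ε makes the logarithmic bound K ≥ 2y. The prefactor is at least 3/4, so the product is at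
  -- least 3y/2 > y.
  have hε : Real.exp (-(2 * y)) ∈ Ioo (0 : ℝ) 1 :=
    ⟨Real.exp_pos _, by simpa using hy⟩
  set ε := Real.exp (-(2 * y)) with hεdef
  have hε2 : ε ^ 2 ∈ Ioo (0 : ℝ) 1 := ⟨pow_pos hε.1 2, pow_lt_one₀ hε.1.le hε.2 two_ne_zero⟩
  refine ⟨1 - ε ^ 2, ⟨by linarith [hε2.2], by linarith [hε2.1]⟩, ?_⟩
  have h1 := log_le_ellF hε
  rw [one_div, Real.log_inv, hεdef, Real.log_exp, ← hεdef, neg_neg] at h1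
  set m := 1 - ε ^ 2 with hm
  have hq : 3 / 4 ≤ 1 - m + m ^ 2 := by nlinarith [sq_nonneg (m - 1 / 2)]
  have hq1 : 1 - m + m ^ 2 ≤ 1 := by nlinarith [hε2.1, hε2.2]
  have hq2 : 1 - m + m ^ 2 ≤ (1 - m + m ^ 2) ^ (1 / 4 : ℝ) := by
    conv_lhs => rw [← Real.rpow_one (1 - m + m ^ 2)]
    exact Real.rpow_le_rpow_of_exponent_ge (by linarith) hq1 (by norm_num)
  have h2 : 3 / 4 * (2 * y) ≤ scaledK m := by
    rw [scaledK]
    exact mul_le_mul (hq.trans hq2) h1 (by linarith) (by linarith)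
  linarith

theorem exists_scaledK_eq {y : ℝ} (hy : Real.pi / 2 < y) : ∃ m ∈ Ioo (0 : ℝ) 1, scaledK m = y := by
  obtain ⟨m, hm, hlt⟩ := exists_lt_scaledK (y := y) (by linarith [Real.pi_pos])
  obtain ⟨x, hx, hxy⟩ := intermediate_value_Ioo hm.1.le
    (contDiffOn_scaledK.continuousOn.mono fun x hx => lt_of_le_of_lt hx.2 hm.2)
    (⟨by rwa [scaledK_zero], hlt⟩ : y ∈ Ioo (scaledK 0) (scaledK m))
  exact ⟨x, ⟨hx.1, hx.2.trans hm.2⟩, hxy⟩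

/-! ### The roots `β₁, β₂, β₃` and the modulus -/

section Roots

variable {c b : ℝ}

theorem disc_eq (c b : ℝ) : disc c b = (5 * (c - 1) / 4 - b) * (5 * (c - 1) / 4 + 3 * b) := by
  rw [disc]; ring

theorem disc_pos (hp : (c, b) ∈ paramSet) : 0 < disc c b := by
  obtain ⟨h1, h2, h3⟩ := hp
  simp only at h1 h2 h3
  rw [disc_eq]
  exact mul_pos (by linarith) (by linarith)

theorem sqrt_disc_pos (hp : (c, b) ∈ paramSet) : 0 < √(disc c b) := Real.sqrt_pos.2 (disc_pos hp)

theorem sq_sqrt_disc (hp : (c, b) ∈ paramSet) :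
    √(disc c b) ^ 2 = (5 * (c - 1) / 4 - b) * (5 * (c - 1) / 4 + 3 * b) := by
  rw [Real.sq_sqrt (disc_pos hp).le, disc_eq]

theorem beta3_sub_beta1 (c b : ℝ) : beta3 c b - beta1 c b = √(disc c b) := by
  rw [beta1, beta3]; ring

theorem beta_sum (c b : ℝ) : beta1 c b + b + beta3 c b = 5 * (c - 1) / 4 := by
  rw [beta1]; ring

/-- β₁ and β₃ are the roots of x² - (s-b)x - b(s-b), with s = 5(c-1)/4, whose discriminant is
`disc`. -/
theorem beta_sum_mul (hp : (c, b) ∈ paramSet) :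
    beta1 c b * b + b * beta3 c b + beta1 c b * beta3 c b = 0 := by
  have := sq_sqrt_disc hp
  rw [beta1, beta3]
  linear_combination (-1 / 4 : ℝ) * this

/-- With s = 5(c-1)/4, the difference of squares is 4b(2s-3b), positive exactly because 0 < b <
2s/3. Both k² ∈ (0,1) and β₂ < β₃ come from this. -/
theorem abs_lt_sqrt_disc (hp : (c, b) ∈ paramSet) :
    |5 * (c - 1) / 4 - 3 * b| < √(disc c b) := by
  refine abs_lt_of_sq_lt_sq ?_ (Real.sqrt_nonneg _)
  rw [sq_sqrt_disc hp]
  obtain ⟨h1, h2, h3⟩ := hp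
  simp only at h1 h2 h3
  nlinarith

theorem modulus_sq_eq (hp : (c, b) ∈ paramSet) :
    modulus c b ^ 2 = (5 * (c - 1) / 4 - 3 * b + √(disc c b)) / (2 * √(disc c b)) := by
  have hD := sqrt_disc_pos hp
  have heq : (5 * (c - 1) - 12 * b) / (8 * √(disc c b)) + 1 / 2 =
      (5 * (c - 1) / 4 - 3 * b + √(disc c b)) / (2 * √(disc c b)) := by
    field_simp
    ring
  rw [modulus, heq, Real.sq_sqrt]
  exact div_nonneg (by linarith [(abs_lt.1 (abs_lt_sqrt_disc hp)).1]) (by linarith)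

theorem modulus_sq_eq_roots (hp : (c, b) ∈ paramSet) :
    modulus c b ^ 2 = (beta3 c b - b) / (beta3 c b - beta1 c b) := by
  rw [modulus_sq_eq hp, beta3_sub_beta1, beta3]
  have hD := sqrt_disc_pos hp
  field_simp
  ring

theorem modulus_sq_mem (hp : (c, b) ∈ paramSet) : modulus c b ^ 2 ∈ Ioo (0 : ℝ) 1 := by
  have hD := sqrt_disc_pos hp
  have := abs_lt.1 (abs_lt_sqrt_disc hp)
  rw [modulus_sq_eq hp]
  exact ⟨div_pos (by linarith) (by linarith), (div_lt_one (by linarith)).2 (by linarith)⟩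

theorem modulus_mem_Ioo (hp : (c, b) ∈ paramSet) : modulus c b ∈ Ioo (0 : ℝ) 1 := by
  have h := modulus_sq_mem hp
  have h0 : 0 ≤ modulus c b := Real.sqrt_nonneg _
  refine ⟨lt_of_le_of_ne h0 fun h1 => ?_, ?_⟩
  · rw [← h1] at h; simp at h
  · exact lt_of_pow_lt_pow_left₀ 2 zero_le_one (by simpa using h.2)

theorem lt_beta3 (hp : (c, b) ∈ paramSet) : b < beta3 c b := by
  have := (abs_lt.1 (abs_lt_sqrt_disc hp)).1
  rw [beta3]
  linarith

/-- The root `β₂` in terms of `c` and the parameter `m = k²`. -/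
noncomputable def beta2 (c m : ℝ) : ℝ :=
  5 * (c - 1) / 12 * (1 + (1 - 2 * m) / √(1 - m + m ^ 2))

/-- With s = 5(c-1)/4 and m = k², 2m-1 = (s-3b)/√Δ and 4(1-m+m²) = 3 + (2m-1)², while 3Δ + (s-3b)² =
4s². -/
theorem sqrt_disc_eq (hp : (c, b) ∈ paramSet) :
    √(disc c b) * √(1 - modulus c b ^ 2 + (modulus c b ^ 2) ^ 2) = 5 * (c - 1) / 4 := by
  have hD := sqrt_disc_pos hp
  have hc : 0 < 5 * (c - 1) / 4 := by have := hp.1; simp only at this; linarith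
  rw [← Real.sqrt_mul (disc_pos hp).le, ← Real.sqrt_sq hc.le]
  congr 1
  rw [modulus_sq_eq hp]
  have h2 := sq_sqrt_disc hp
  have h3 := (Real.sq_sqrt (disc_pos hp).le).symm
  generalize √(disc c b) = D at *
  rw [h3]
  field_simp
  linear_combination 48 * h2

theorem beta2_modulus_sq (hp : (c, b) ∈ paramSet) : beta2 c (modulus c b ^ 2) = b := by
  have hD := sqrt_disc_pos hp
  have h1 := sqrt_disc_eq hp
  have hq := Real.sqrt_pos.2 (one_sub_add_sq_pos (modulus c b ^ 2))
  have h2 : 1 - 2 * modulus c b ^ 2 = (3 * b - 5 * (c - 1) / 4) / √(disc c b) := by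
    rw [modulus_sq_eq hp]
    field_simp
    ring
  have hc : 0 < c - 1 := by have := hp.1; simp only at this; linarith
  rw [beta2, h2, div_div, h1]
  field_simp
  ring

/-- The squares differ by (1-m+m²) - (1-2m)² = 3m(1-m). -/
theorem beta2_aux {m : ℝ} (hm : m ∈ Ioo (0 : ℝ) 1) :
    |(1 - 2 * m) / √(1 - m + m ^ 2)| < 1 := by
  have hq := one_sub_add_sq_pos m
  have hq' := Real.sqrt_pos.2 hq
  rw [abs_div, abs_of_pos hq', div_lt_one hq']
  refine abs_lt_of_sq_lt_sq ?_ hq'.le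
  rw [Real.sq_sqrt hq.le]
  nlinarith [mul_pos hm.1 (sub_pos.2 hm.2)]

theorem beta2_mem {m : ℝ} (hc : 1 < c) (hm : m ∈ Ioo (0 : ℝ) 1) :
    (c, beta2 c m) ∈ paramSet := by
  have h := abs_lt.1 (beta2_aux hm)
  refine ⟨hc, ?_, ?_⟩ <;> simp only [beta2] <;> nlinarith

theorem modulus_beta2_sq {m : ℝ} (hc : 1 < c) (hm : m ∈ Ioo (0 : ℝ) 1) :
    modulus c (beta2 c m) ^ 2 = m := by
  have hp := beta2_mem hc hm
  have hq := one_sub_add_sq_pos m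
  have hq' := Real.sqrt_pos.2 hq
  have hq2 := Real.sq_sqrt hq.le
  have hD : √(disc c (beta2 c m)) = 5 * (c - 1) / 4 / √(1 - m + m ^ 2) := by
    have h0 : 0 ≤ 5 * (c - 1) / 4 / √(1 - m + m ^ 2) := div_nonneg (by linarith) hq'.le
    rw [← Real.sqrt_sq h0]
    congr 1
    rw [disc_eq, beta2]
    field_simp
    linear_combination 192 * (c - 1) ^ 2 * hq2
  have hc' : 0 < c - 1 := by linarith
  rw [modulus_sq_eq hp, hD, beta2]
  field_simp
  ring

/-! ### The period function -/

theorem disc_rpow (hp : (c, b) ∈ paramSet) : disc c b ^ (1 / 4 : ℝ) = √(√(disc c b)) := by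
  rw [Real.sqrt_eq_rpow, Real.sqrt_eq_rpow, ← Real.rpow_mul (disc_pos hp).le]
  norm_num

theorem periodFun_eq (hp : (c, b) ∈ paramSet) :
    periodFun c b = 8 * √(c / (c - 1)) * scaledK (modulus c b ^ 2) := by
  have hD := sqrt_disc_pos hp
  have hD' := Real.sqrt_pos.2 hD
  have hc : 0 < c - 1 := by have := hp.1; simp only at this; linarith
  have hq := one_sub_add_sq_pos (modulus c b ^ 2)
  have hq4 : (1 - modulus c b ^ 2 + (modulus c b ^ 2) ^ 2) ^ (1 / 4 : ℝ) =
      √(√(1 - modulus c b ^ 2 + (modulus c b ^ 2) ^ 2)) := by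
    rw [Real.sqrt_eq_rpow, Real.sqrt_eq_rpow, ← Real.rpow_mul hq.le]
    norm_num
  have h1 : √(√(disc c b)) * √(√(1 - modulus c b ^ 2 + (modulus c b ^ 2) ^ 2)) =
      √(5 * (c - 1) / 4) := by
    rw [← Real.sqrt_mul hD.le, sqrt_disc_eq hp]
  have h2 : √(5 * c) = 2 * (√(c / (c - 1)) * √(5 * (c - 1) / 4)) := by
    have h4 : (2 : ℝ) = √4 := by
      rw [show (4 : ℝ) = 2 ^ 2 by norm_num, Real.sqrt_sq zero_le_two]
    rw [← Real.sqrt_mul (div_nonneg (by linarith) hc.le), h4, ← Real.sqrt_mul (by norm_num)]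
    congr 1
    field_simp
  rw [periodFun, ellipticK_eq, scaledK, disc_rpow hp, hq4, h2, ← h1]
  field_simp
  ring

end Roots

/-- The inverse of `scaledK : (0, 1) → (π / 2, ∞)`. -/
noncomputable def scaledKInv (y : ℝ) : ℝ := Function.invFunOn scaledK (Ioo 0 1) y

theorem scaledKInv_mem {y : ℝ} (hy : Real.pi / 2 < y) : scaledKInv y ∈ Ioo (0 : ℝ) 1 :=
  Function.invFunOn_mem (exists_scaledK_eq hy)

theorem scaledK_scaledKInv {y : ℝ} (hy : Real.pi / 2 < y) : scaledK (scaledKInv y) = y :=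
  Function.invFunOn_eq (exists_scaledK_eq hy)

theorem injOn_scaledK : InjOn scaledK (Ioo 0 1) :=
  (strictMonoOn_scaledK.mono Ioo_subset_Ico_self).injOn

/-- Implicit function argument for `scaledK m = y`. Solutions are restricted to (0,1), where
`scaledK` is injective with positive derivative. -/
theorem contDiffOn_scaledKInv : ContDiffOn ℝ ∞ scaledKInv (Ioi (Real.pi / 2)) := by
  intro y hy
  refine ContDiffAt.contDiffWithinAt ?_
  have hm := scaledKInv_mem hy
  obtain ⟨d, hd, hder⟩ := exists_hasDerivAt_scaledK_pos hm
  refine contDiffAt_of_implicit (S := Ioo 0 1) (f := fun q : ℝ × ℝ => scaledK q.2 - q.1) (d := d)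
    ?_ (by simp) (hder.sub_const _) hd.ne' (isOpen_Ioo.mem_nhds hm) ?_
  · refine ContDiffAt.sub (ContDiffAt.comp (g := scaledK) (f := fun q : ℝ × ℝ => q.2)
      (y, scaledKInv y) (contDiffOn_scaledK.contDiffAt (isOpen_Iio.mem_nhds hm.2)) (by fun_prop))
      (by fun_prop)
  · filter_upwards [isOpen_Ioi.mem_nhds hy] with x hx m hmem h
    simp only [scaledK_scaledKInv hy, sub_self, sub_eq_zero] at h
    exact injOn_scaledK hmem (scaledKInv_mem hx) (by rw [h, scaledK_scaledKInv hx])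

/-! ### The parameter curve of waves of period `L` -/

section Curve

variable {L : ℝ}

/-- The value that `scaledK` has to take in order that the period be `L`. -/
noncomputable def level (L c : ℝ) : ℝ := L / (8 * √(c / (c - 1)))

/-- The curve `β₂ = Λ(c)` of waves of period `L`. -/
noncomputable def curve (L c : ℝ) : ℝ := beta2 c (scaledKInv (level L c))

theorem periodFun_eq_iff {c b : ℝ} (hp : (c, b) ∈ paramSet) :
    periodFun c b = L ↔ scaledK (modulus c b ^ 2) = level L c := by
  have hc : 1 < c := hp.1
  have : 0 < √(c / (c - 1)) := Real.sqrt_pos.2 (div_pos (by linarith) (by linarith))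
  rw [periodFun_eq hp, level, eq_div_iff (by positivity), mul_comm]

theorem one_lt_of_threshold_lt (hL : 4 * Real.pi < L) {c : ℝ}
    (hc : L ^ 2 / (L ^ 2 - 16 * Real.pi ^ 2) < c) : 1 < c := by
  have hpi := Real.pi_pos
  have h : 0 < L ^ 2 - 16 * Real.pi ^ 2 := by nlinarith
  refine lt_of_le_of_lt ?_ hc
  rw [one_le_div h]
  nlinarith

/-- After squaring, the inequality reads 16π² c/(c-1) < L²; this is where the threshold on c comes
from. -/
theorem pi_div_two_lt_level (hL : 4 * Real.pi < L) {c : ℝ}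
    (hc : L ^ 2 / (L ^ 2 - 16 * Real.pi ^ 2) < c) : Real.pi / 2 < level L c := by
  have hpi := Real.pi_pos
  have h : 0 < L ^ 2 - 16 * Real.pi ^ 2 := by nlinarith
  have hc1 := one_lt_of_threshold_lt hL hc
  have hq : 0 < c / (c - 1) := div_pos (by linarith) (by linarith)
  rw [level, lt_div_iff₀ (mul_pos (by norm_num) (Real.sqrt_pos.2 hq))]
  refine lt_of_pow_lt_pow_left₀ 2 (by linarith) ?_
  rw [mul_pow, mul_pow, Real.sq_sqrt hq.le]
  rw [div_lt_iff₀ h] at hc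
  have : (Real.pi / 2) ^ 2 * (8 ^ 2 * (c / (c - 1))) = 16 * Real.pi ^ 2 * c / (c - 1) := by ring
  rw [this, div_lt_iff₀ (by linarith)]
  linarith

theorem curve_mem (hL : 4 * Real.pi < L) {c : ℝ}
    (hc : L ^ 2 / (L ^ 2 - 16 * Real.pi ^ 2) < c) : (c, curve L c) ∈ paramSet :=
  beta2_mem (one_lt_of_threshold_lt hL hc) (scaledKInv_mem (pi_div_two_lt_level hL hc))

theorem periodFun_curve (hL : 4 * Real.pi < L) {c : ℝ}
    (hc : L ^ 2 / (L ^ 2 - 16 * Real.pi ^ 2) < c) : periodFun c (curve L c) = L := by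
  have hy := pi_div_two_lt_level hL hc
  rw [periodFun_eq_iff (curve_mem hL hc), curve,
    modulus_beta2_sq (one_lt_of_threshold_lt hL hc) (scaledKInv_mem hy), scaledK_scaledKInv hy]

theorem eq_of_periodFun_eq {c b b' : ℝ} (hp : (c, b) ∈ paramSet) (hp' : (c, b') ∈ paramSet)
    (h : periodFun c b = L) (h' : periodFun c b' = L) : b = b' := by
  rw [periodFun_eq_iff hp] at h
  rw [periodFun_eq_iff hp'] at h'
  rw [← beta2_modulus_sq hp, ← beta2_modulus_sq hp',
    injOn_scaledK (modulus_sq_mem hp) (modulus_sq_mem hp') (h.trans h'.symm)]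

theorem contDiffOn_curve (hL : 4 * Real.pi < L) :
    ContDiffOn ℝ ∞ (curve L) (Ioi (L ^ 2 / (L ^ 2 - 16 * Real.pi ^ 2))) := by
  have h1 : ∀ c ∈ Ioi (L ^ 2 / (L ^ 2 - 16 * Real.pi ^ 2)), 0 < c - 1 := fun c hc => by
    linarith [one_lt_of_threshold_lt hL hc]
  have h2 : ∀ c ∈ Ioi (L ^ 2 / (L ^ 2 - 16 * Real.pi ^ 2)), 0 < c / (c - 1) := fun c hc =>
    div_pos (by linarith [h1 c hc]) (h1 c hc)
  have hlevel : ContDiffOn ℝ ∞ (level L) (Ioi (L ^ 2 / (L ^ 2 - 16 * Real.pi ^ 2))) := by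
    refine ContDiffOn.div contDiffOn_const (ContDiffOn.mul contDiffOn_const
      (ContDiffOn.sqrt (ContDiffOn.div (by fun_prop) (by fun_prop) fun c hc => (h1 c hc).ne')
        fun c hc => (h2 c hc).ne')) fun c hc => ?_
    exact (mul_pos (by norm_num) (Real.sqrt_pos.2 (h2 c hc))).ne'
  have hm : ContDiffOn ℝ ∞ (fun c => scaledKInv (level L c))
      (Ioi (L ^ 2 / (L ^ 2 - 16 * Real.pi ^ 2))) :=
    contDiffOn_scaledKInv.comp hlevel fun c hc => pi_div_two_lt_level hL hc
  refine ContDiffOn.mul (by fun_prop) (contDiffOn_const.add (ContDiffOn.div ?_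
    (ContDiffOn.sqrt ?_ fun c _ => (one_sub_add_sq_pos _).ne')
    fun c _ => (Real.sqrt_pos.2 (one_sub_add_sq_pos _)).ne'))
  · exact contDiffOn_const.sub (contDiffOn_const.mul hm)
  · exact (contDiffOn_const.sub hm).add (hm.pow 2)

end Curve

/-! ### The cnoidal waves -/

section Wave

variable {c b : ℝ}

/-- The wave number of the cnoidal wave. -/
noncomputable def waveNumber (c b : ℝ) : ℝ := √(√(disc c b) / (20 * c))

theorem wave_eq (c b : ℝ) : wave c b = fun z => (b + (beta3 c b - b) *
    Real.cos (ellAm (modulus c b ^ 2) (waveNumber c b * z)) ^ 2) ^ 2 := by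
  ext z
  rw [wave, jacobiCN_eq, beta3_sub_beta1, beta_sum, waveNumber,
    show 16 * (5 * (c - 1) / 4) + 20 = 20 * c by ring]

theorem waveNumber_pos (hp : (c, b) ∈ paramSet) : 0 < waveNumber c b := by
  have hc : 1 < c := hp.1
  exact Real.sqrt_pos.2 (div_pos (sqrt_disc_pos hp) (by linarith))

/-- One period advances the argument of cn by 2K, hence the amplitude by π, which leaves cn²
unchanged. -/
theorem waveNumber_mul_periodFun (hp : (c, b) ∈ paramSet) :
    waveNumber c b * periodFun c b = 2 * ellF (modulus c b ^ 2) (Real.pi / 2) := by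
  have hc : 1 < c := hp.1
  have hD := Real.sqrt_pos.2 (sqrt_disc_pos hp)
  have h5 : 0 < √(5 * c) := Real.sqrt_pos.2 (by linarith)
  have h20 : √(20 * c) = 2 * √(5 * c) := by
    have h4 : (2 : ℝ) = √4 := by
      rw [show (4 : ℝ) = 2 ^ 2 by norm_num, Real.sqrt_sq zero_le_two]
    rw [h4, ← Real.sqrt_mul (by norm_num)]
    congr 1
    ring
  rw [waveNumber, periodFun, disc_rpow hp, ellipticK_eq, Real.sqrt_div (sqrt_disc_pos hp).le, h20]
  field_simp
  ring

theorem ellF_pi_div_two_pos {m : ℝ} (hm : m < 1) : 0 < ellF m (Real.pi / 2) := by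
  rw [← ellF_zero m]
  exact strictMono_ellF hm (by positivity)

theorem periodFun_pos (hp : (c, b) ∈ paramSet) : 0 < periodFun c b := by
  have h := waveNumber_mul_periodFun hp
  have hK := ellF_pi_div_two_pos (modulus_sq_mem hp).2
  exact pos_of_mul_pos_right (by rw [h]; linarith) (waveNumber_pos hp).le

theorem periodic_wave (hp : (c, b) ∈ paramSet) :
    Function.Periodic (wave c b) (periodFun c b) := by
  have hm := modulus_sq_mem hp
  intro z
  rw [wave_eq]
  simp only
  rw [mul_add, waveNumber_mul_periodFun hp, ellAm_add hm.1.le hm.2, Real.cos_add_pi, neg_sq]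

theorem ellF_int_mul_pi {m : ℝ} (hm : m < 1) (n : ℤ) :
    ellF m (n * Real.pi) = n * (2 * ellF m (Real.pi / 2)) := by
  induction n using Int.induction_on with
  | zero => simp [ellF_zero]
  | succ n ih =>
    push_cast at ih ⊢
    rw [add_mul, one_mul, ellF_add_pi hm, ih]
    ring
  | pred n ih =>
    have := ellF_add_pi hm ((-(n : ℝ) - 1) * Real.pi)
    rw [show (-(n : ℝ) - 1) * Real.pi + Real.pi = -n * Real.pi by ring] at this
    push_cast at ih ⊢
    rw [ih] at this
    linarith

/-- At 0 the wave has its maximum β₃². A period T must return to it, which forces cos² = 1, so the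
amplitude is nπ and T is a positive integer multiple of the claimed period. -/
theorem isFundamentalPeriod_wave (hp : (c, b) ∈ paramSet) :
    IsFundamentalPeriod (wave c b) (periodFun c b) := by
  refine ⟨periodFun_pos hp, periodic_wave hp, fun T hT hper => ?_⟩
  have hm := modulus_sq_mem hp
  have hK := ellF_pi_div_two_pos hm.2
  have hw := waveNumber_pos hp
  have hb : 0 < b := hp.2.1
  have hδ : 0 < beta3 c b - b := sub_pos.2 (lt_beta3 hp)
  have h0 := hper 0
  rw [zero_add, wave_eq] at h0
  simp only [mul_zero, ellAm_zero hm.2, Real.cos_zero] at h0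
  set A := ellAm (modulus c b ^ 2) (waveNumber c b * T) with hA
  have h1 : b + (beta3 c b - b) * Real.cos A ^ 2 = b + (beta3 c b - b) * 1 ^ 2 :=
    (pow_left_inj₀ (by positivity) (by positivity) two_ne_zero).1 h0
  have h2 : Real.cos A ^ 2 = 1 := by
    have := mul_left_cancel₀ hδ.ne' (add_left_cancel h1)
    simpa using this
  have h3 : Real.sin A = 0 := by
    have := Real.sin_sq_add_cos_sq A
    rw [h2] at this
    exact pow_eq_zero_iff two_ne_zero |>.1 (by linarith)
  obtain ⟨n, hn⟩ := Real.sin_eq_zero_iff.1 h3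
  have h4 : waveNumber c b * T = n * (waveNumber c b * periodFun c b) := by
    rw [waveNumber_mul_periodFun hp, ← ellF_int_mul_pi hm.2, hn, hA, ellF_ellAm hm.1.le hm.2]
  have h5 : T = n * periodFun c b := by
    apply mul_left_cancel₀ hw.ne'
    rw [h4]; ring
  have h6 : (0 : ℝ) < n := by
    by_contra! hneg
    have := mul_nonpos_of_nonpos_of_nonneg hneg (periodFun_pos hp).le
    linarith
  have h7 : (1 : ℝ) ≤ n := by
    exact_mod_cast (Int.cast_pos.1 h6 : 0 < n)
  rw [h5]
  nlinarith [periodFun_pos hp]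

theorem contDiff_wave (hp : (c, b) ∈ paramSet) : ContDiff ℝ ∞ (wave c b) := by
  have hm := modulus_sq_mem hp
  have hA : ContDiff ℝ ∞ fun z => ellAm (modulus c b ^ 2) (waveNumber c b * z) := by
    refine contDiffOn_univ.1 (contDiffOn_ellAm.comp
      (f := fun z : ℝ => (modulus c b ^ 2, waveNumber c b * z)) (by fun_prop) fun z _ => ?_)
    exact ⟨hm, mem_univ _⟩
  rw [wave_eq]
  exact (contDiff_const.add (contDiff_const.mul ((Real.contDiff_cos.comp hA).pow 2))).pow 2

/-- The second derivative of a squared quadratic polynomial in `cn`. -/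
theorem deriv_deriv_cnoidal {m : ℝ} (hm : m ∈ Ioo (0 : ℝ) 1) (b δ w z : ℝ) :
    deriv (deriv fun z => (b + δ * Real.cos (ellAm m (w * z)) ^ 2) ^ 2) z =
      (8 * δ ^ 2 * (Real.cos (ellAm m (w * z)) ^ 2 * Real.sin (ellAm m (w * z)) ^ 2) *
          (1 - m * Real.sin (ellAm m (w * z)) ^ 2) -
        4 * δ * (b + δ * Real.cos (ellAm m (w * z)) ^ 2) *
          ((Real.cos (ellAm m (w * z)) ^ 2 - Real.sin (ellAm m (w * z)) ^ 2) *
              (1 - m * Real.sin (ellAm m (w * z)) ^ 2) -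
            m * (Real.cos (ellAm m (w * z)) ^ 2 * Real.sin (ellAm m (w * z)) ^ 2))) * w ^ 2 := by
  set A : ℝ → ℝ := fun z => ellAm m (w * z) with hAdef
  set R : ℝ → ℝ := fun z => √(1 - m * Real.sin (A z) ^ 2) with hRdef
  have hR : ∀ z, 0 < R z := fun z => Real.sqrt_pos.2 (one_sub_mul_sin_sq_pos hm.2 _)
  have hR2 : ∀ z, R z ^ 2 = 1 - m * Real.sin (A z) ^ 2 := fun z =>
    Real.sq_sqrt (one_sub_mul_sin_sq_pos hm.2 _).le
  have hA : ∀ z, HasDerivAt A (R z * w) z := fun z =>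
    (hasDerivAt_ellAm hm (w * z)).comp z (by simpa using (hasDerivAt_id z).const_mul w)
  have hs : ∀ z, HasDerivAt (fun z => Real.sin (A z)) (Real.cos (A z) * (R z * w)) z :=
    fun z => (hA z).sin
  have hc : ∀ z, HasDerivAt (fun z => Real.cos (A z)) (-Real.sin (A z) * (R z * w)) z :=
    fun z => (hA z).cos
  have hRd : ∀ z, HasDerivAt R (-(m * Real.sin (A z) * Real.cos (A z) * w)) z := fun z => by
    refine (((((hs z).fun_pow 2).const_mul m).const_sub 1).sqrt
      (one_sub_mul_sin_sq_pos hm.2 _).ne').congr_deriv ?_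
    change _ / (2 * R z) = _
    have := (hR z).ne'
    field_simp
    norm_num
    ring
  have hψ : ∀ z, HasDerivAt (fun z => b + δ * Real.cos (A z) ^ 2)
      (-(2 * δ * w) * (Real.cos (A z) * Real.sin (A z) * R z)) z := fun z => by
    refine ((((hc z).fun_pow 2).const_mul δ).const_add b).congr_deriv ?_
    norm_num
    ring
  have h1 : (deriv fun z => (b + δ * Real.cos (A z) ^ 2) ^ 2) = fun z =>
      -(4 * δ * w) * ((b + δ * Real.cos (A z) ^ 2) * (Real.cos (A z) * Real.sin (A z) * R z)) := by
    ext z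
    rw [((hψ z).fun_pow 2).deriv]
    norm_num
    ring
  change deriv (deriv fun z => (b + δ * Real.cos (A z) ^ 2) ^ 2) z = _
  rw [h1, (((hψ z).fun_mul (((hc z).fun_mul (hs z)).fun_mul (hRd z))).const_mul _).deriv]
  change _ = (8 * δ ^ 2 * (Real.cos (A z) ^ 2 * Real.sin (A z) ^ 2) *
    (1 - m * Real.sin (A z) ^ 2) - 4 * δ * (b + δ * Real.cos (A z) ^ 2) *
      ((Real.cos (A z) ^ 2 - Real.sin (A z) ^ 2) * (1 - m * Real.sin (A z) ^ 2) -
        m * (Real.cos (A z) ^ 2 * Real.sin (A z) ^ 2))) * w ^ 2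
  rw [← hR2]
  ring

/-- For P(ψ) = (ψ-β₁)(ψ-β₂)(β₃-ψ), cψ'² = P/5 gives cφ'' = (2P + ψP')/5. The sum of the roots
supplies the coefficient c-1, their product supplies A, and the term linear in ψ vanishes by
`beta_sum_mul`. -/
theorem isPositiveSolution_wave (hp : (c, b) ∈ paramSet) :
    IsPositiveSolution c (constA c b) (wave c b) := by
  refine ⟨contDiff_wave hp, fun z => ?_⟩
  have hc : 1 < c := hp.1
  have hb : 0 < b := hp.2.1
  have hδ : 0 < beta3 c b - b := sub_pos.2 (lt_beta3 hp)
  have hm := modulus_sq_mem hp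
  have hmD := modulus_sq_eq_roots hp
  rw [eq_div_iff (by rw [beta3_sub_beta1]; exact (sqrt_disc_pos hp).ne')] at hmD
  have hw2 : c * waveNumber c b ^ 2 = (beta3 c b - beta1 c b) / 20 := by
    rw [waveNumber, Real.sq_sqrt (div_nonneg (Real.sqrt_nonneg _) (by linarith)), beta3_sub_beta1]
    field_simp
  have hsum := beta_sum c b
  have he2 := beta_sum_mul hp
  rw [constA]
  rw [wave_eq, deriv_deriv_cnoidal hm]
  simp only
  generalize ellAm (modulus c b ^ 2) (waveNumber c b * z) = A
  generalize beta3 c b = β₃ at *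
  generalize beta1 c b = β₁ at *
  generalize modulus c b ^ 2 = m at *
  generalize waveNumber c b = w at *
  have hψ : 0 < b + (β₃ - b) * Real.cos A ^ 2 := by positivity
  refine ⟨by positivity, ?_⟩
  have hpow : ((b + (β₃ - b) * Real.cos A ^ 2) ^ 2) ^ (3 / 2 : ℝ) =
      (b + (β₃ - b) * Real.cos A ^ 2) ^ 3 := by
    generalize b + (β₃ - b) * Real.cos A ^ 2 = ψ at hψ
    rw [← Real.rpow_natCast, ← Real.rpow_natCast, ← Real.rpow_mul hψ.le]
    norm_num
  rw [hpow]
  have hsin := Real.sin_sq A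
  have hc4 : c - 1 = 4 / 5 * (β₁ + b + β₃) := by linarith
  rw [hc4, hsin]
  generalize Real.cos A ^ 2 = q
  -- The coefficients eliminate c·w² and then m(β₃-β₁); what remains is 3/5 · ψ times the second
  -- symmetric function of the roots.
  linear_combination
    -(8 * (β₃ - b) ^ 2 * (q * (1 - q)) * (1 - m * (1 - q)) - 4 * (β₃ - b) * (b + (β₃ - b) * q) *
      ((q - (1 - q)) * (1 - m * (1 - q)) - m * (q * (1 - q)))) * hw2 -
    1 / 20 * (-(8 * (β₃ - b) ^ 2 * q * (1 - q) ^ 2) - 4 * (β₃ - b) * (b + (β₃ - b) * q) *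
      (-((2 * q - 1) * (1 - q)) - q * (1 - q))) * hmD +
    3 / 5 * (b + (β₃ - b) * q) * he2

end Wave

/-! ### The curve of waves of period `L` -/

theorem contDiffOn_wave_comp {J : Set ℝ} {Λ : ℝ → ℝ} (hΛ : ContDiffOn ℝ ∞ Λ J)
    (hp : ∀ c ∈ J, (c, Λ c) ∈ paramSet) :
    ContDiffOn ℝ ∞ (fun p : ℝ × ℝ => wave p.1 (Λ p.1) p.2) (J ×ˢ univ) := by
  have hfst : MapsTo (Prod.fst : ℝ × ℝ → ℝ) (J ×ˢ univ) J := fun p hp => hp.1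
  have hdisc : ContDiffOn ℝ ∞ (fun c => disc c (Λ c)) J := by
    unfold disc
    fun_prop
  have hD : ContDiffOn ℝ ∞ (fun c => √(disc c (Λ c))) J :=
    hdisc.sqrt fun c hc => (disc_pos (hp c hc)).ne'
  have hβ : ContDiffOn ℝ ∞ (fun c => beta3 c (Λ c)) J := by
    unfold beta3
    fun_prop
  -- The wave depends on k only through k², which is rational in c, Λ and √Δ; the outer root in
  -- `modulus` needs no treatment.
  have hm : ContDiffOn ℝ ∞ (fun c => modulus c (Λ c) ^ 2) J := by
    refine ContDiffOn.congr (f := fun c =>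
      (5 * (c - 1) / 4 - 3 * Λ c + √(disc c (Λ c))) / (2 * √(disc c (Λ c)))) ?_
      fun c hc => modulus_sq_eq (hp c hc)
    exact ContDiffOn.div (by fun_prop) (by fun_prop) fun c hc =>
      (mul_pos two_pos (sqrt_disc_pos (hp c hc))).ne'
  have hw : ContDiffOn ℝ ∞ (fun c => waveNumber c (Λ c)) J := by
    have hc : ∀ c ∈ J, 0 < 20 * c := fun c hc => by
      have : 1 < c := (hp c hc).1
      linarith
    exact (hD.div (by fun_prop) fun c h => (hc c h).ne').sqrt fun c h =>
      (div_pos (sqrt_disc_pos (hp c h)) (hc c h)).ne'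
  have hA : ContDiffOn ℝ ∞ (fun p : ℝ × ℝ =>
      ellAm (modulus p.1 (Λ p.1) ^ 2) (waveNumber p.1 (Λ p.1) * p.2)) (J ×ˢ univ) := by
    refine contDiffOn_ellAm.comp (f := fun p : ℝ × ℝ =>
      (modulus p.1 (Λ p.1) ^ 2, waveNumber p.1 (Λ p.1) * p.2)) ?_
      fun p h => ⟨modulus_sq_mem (hp p.1 h.1), mem_univ _⟩
    exact (hm.comp contDiffOn_fst hfst).prodMk ((hw.comp contDiffOn_fst hfst).mul contDiffOn_snd)
  simp only [wave_eq]
  exact ((hΛ.comp contDiffOn_fst hfst).add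
    (((hβ.comp contDiffOn_fst hfst).sub (hΛ.comp contDiffOn_fst hfst)).mul
      ((Real.contDiff_cos.comp_contDiffOn hA).pow 2))).pow 2

/-- Serves both the local and the global assertion. Uniqueness is pointwise in c, so neither
continuity of the competitor nor the choice of `J` and `B` plays a role in it. -/
theorem isWaveCurve_curve {L c₀ β₀ : ℝ} (hL : 4 * Real.pi < L) {J B : Set ℝ}
    (hJ : IsIntervalAround J c₀) (hB : IsIntervalAround B β₀)
    (hJL : J ⊆ Ioi (L ^ 2 / (L ^ 2 - 16 * Real.pi ^ 2))) (hmaps : MapsTo (curve L) J B)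
    (hbase : curve L c₀ = β₀) : IsWaveCurve L c₀ β₀ J B (curve L) := by
  have hmem : ∀ c ∈ J, (c, curve L c) ∈ paramSet := fun c hc => curve_mem hL (hJL hc)
  have hper : ∀ c ∈ J, periodFun c (curve L c) = L := fun c hc => periodFun_curve hL (hJL hc)
  have hsmooth := (contDiffOn_curve hL).mono hJL
  have hfund : ∀ c ∈ J, IsFundamentalPeriod (wave c (curve L c)) L := fun c hc => by
    have := isFundamentalPeriod_wave (hmem c hc)
    rwa [hper c hc] at this
  exact
    { interval_J := hJ
      interval_B := hB
      mapsTo := hmaps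
      base := hbase
      admissible := hmem
      period_eq := hper
      modulus_mem := fun c hc => modulus_mem_Ioo (hmem c hc)
      modulus_sq := fun c hc => modulus_sq_eq_roots (hmem c hc)
      unique := fun Λ' _ h c hc =>
        eq_of_periodFun_eq (h c hc).2.1 (hmem c hc) (h c hc).2.2 (hper c hc)
      smooth := hsmooth
      solution := fun c hc => isPositiveSolution_wave (hmem c hc)
      fundamental := hfund
      smooth_wave := exists_smoothCurveOn_of_contDiffOn hJ.1
        (f := fun p => wave p.1 (curve L p.1) p.2) (contDiffOn_wave_comp hsmooth hmem)
        fun c hc => (hfund c hc).2.1 }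

theorem isOpen_paramSet : IsOpen paramSet :=
  (isOpen_lt continuous_const continuous_fst).inter
    ((isOpen_lt continuous_const continuous_snd).inter
      (isOpen_lt continuous_snd (by fun_prop)))

theorem isIntervalAround_ball (x : ℝ) {r : ℝ} (hr : 0 < r) :
    IsIntervalAround (Metric.ball x r) x :=
  ⟨Metric.isOpen_ball, (convex_ball x r).ordConnected, Metric.mem_ball_self hr⟩

end Schamel

/-! ### The main theorem -/

theorem theorem3p6 (L : ℝ) (hL : 4 * Real.pi < L) (c₀ : ℝ)
    (hc₀ : L ^ 2 / (L ^ 2 - 16 * Real.pi ^ 2) < c₀) :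
    (∃! β₀ : ℝ, (c₀, β₀) ∈ Schamel.paramSet ∧ Schamel.periodFun c₀ β₀ = L) ∧
    ∀ β₀ : ℝ, (c₀, β₀) ∈ Schamel.paramSet → Schamel.periodFun c₀ β₀ = L →
      ∃ (J B : Set ℝ) (Λ : ℝ → ℝ),
        J ×ˢ B ⊆ Schamel.paramSet ∧
        Schamel.IsWaveCurve L c₀ β₀ J B Λ ∧
        J ⊆ Set.Ioi (L ^ 2 / (L ^ 2 - 16 * Real.pi ^ 2)) ∧
        ∃ Λ' : ℝ → ℝ, Set.EqOn Λ' Λ J ∧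
          Schamel.IsWaveCurve L c₀ β₀ (Set.Ioi (L ^ 2 / (L ^ 2 - 16 * Real.pi ^ 2)))
            (Set.Ioi 0) Λ' := by
  open Schamel in
  have hmem := curve_mem hL hc₀
  have hper := periodFun_curve hL hc₀
  refine ⟨⟨curve L c₀, ⟨hmem, hper⟩, fun b hb => eq_of_periodFun_eq hb.1 hmem hb.2 hper⟩,
    fun β₀ hβ hβL => ?_⟩
  have hbase : curve L c₀ = β₀ := eq_of_periodFun_eq hmem hβ hper hβL
  -- A ball for the product metric is a product of balls, which provides `B`; `J` is then shrunk so
  -- that the curve maps it into `B`.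
  obtain ⟨ε, hε, hball⟩ := Metric.isOpen_iff.1 isOpen_paramSet _ hβ
  rw [← ball_prod_same] at hball
  have hcont : ContinuousAt (curve L) c₀ :=
    (contDiffOn_curve hL).continuousOn.continuousAt (Ioi_mem_nhds hc₀)
  have hev : ∀ᶠ c in 𝓝 c₀, curve L c ∈ Metric.ball β₀ ε :=
    hcont.eventually_mem (by rw [hbase]; exact Metric.ball_mem_nhds _ hε)
  obtain ⟨δ, hδ, hδball⟩ := Metric.eventually_nhds_iff_ball.1
    ((hev.and (Ioi_mem_nhds hc₀)).and (Metric.ball_mem_nhds c₀ hε))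
  have hJL : Metric.ball c₀ δ ⊆ Ioi (L ^ 2 / (L ^ 2 - 16 * Real.pi ^ 2)) :=
    fun c hc => (hδball c hc).1.2
  exact ⟨Metric.ball c₀ δ, Metric.ball β₀ ε, curve L,
    (prod_mono (fun c hc => (hδball c hc).2) Subset.rfl).trans hball,
    isWaveCurve_curve hL (isIntervalAround_ball _ hδ) (isIntervalAround_ball _ hε) hJL
      (fun c hc => (hδball c hc).1.1) hbase, hJL, curve L, fun _ _ => rfl,
    isWaveCurve_curve hL ⟨isOpen_Ioi, ordConnected_Ioi, hc₀⟩
      ⟨isOpen_Ioi, ordConnected_Ioi, hβ.2.1⟩ Subset.rfl (fun c hc => (curve_mem hL hc).2.1) hbase⟩
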